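/- **Setting.** Let $D\subset\mathbb R^d$ be a domain (non-empty, open, connected) and let $$Au(x)=\tfrac12\operatorname{Tr}\big(\mathbf Q(x)\nabla^2u(x)\big)+b(x)\cdot\nabla u(x)+\int_{\mathbb R^d}\Big(u(x+y)-u(x)-\frac{y\cdot\nabla u(x)}{1+|y|^2}\Big)N(x,dy),$$ where $\mathbf Q=[q_{i,j}]$ and $b$ are Borel on $\mathbb R^d$ and bounded on $D$, $\sum_{i,j} q_{i,j}(x)\xi_i\xi_j\ge0$ for $x\in D$, $\xi\in\mathbb R^d$, and $N$ is a Borel kernel with $N(x,\{0\})=0$ and $\sup_{x\in\mathbb R^d}\int\min\{1,|y|^2\}\,N(x,dy)<\infty$. Let $c:D\to[0,\infty)$ be bounded and Borel, put $\bar c=\sup_Dc$, and let $g:D\to(-\infty,0]$ be Borel. Let $(X_t)_{t\ge0}$ be the canonical process on the space of càdlàg paths $[0,\infty)\to\mathbb R^d$ and $(\mathcal F_t)$ its natural filtration. A probability measure $P_\mu$ on path space solves the martingale problem for $A$ with initial law $\mu$ if $X_0$ has law $\mu$ under $P_\mu$ and, for every $f\in C^2(\mathbb R^d)$ bounded with its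 first two derivatives, the integral in $M_t[f]=f(X_t)-f(X_0)-\int_0^tAf(X_r)\,dr$ exists $P_\mu$-a.s. and $(M_t[f])_{t\ge 0}$ is an $(\mathcal F_t)$-martingale under $P_\mu$. Assume that $(P_x)_{x\in\mathbb R^d}$ is a strong Markovian solution: $P_x$ solves the problem with initial law $\delta_x$; $x\mapsto P_x[C]$ is measurable for all measurable $C$; the strong Markov property holds with respect to $(\mathcal F_t)$; and $\int P_x\,\mu(dx)$ solves the problem with initial law $\mu$ for each Borel probability measure $\mu$. Let $\tau_D=\inf\{t>0:X_t\notin D\}$ and assume $P_x[\tau_D<\infty]=1$ for all $x\in D$. Put, for $t,\alpha\ge0$ and Borel $f\ge0$ on $D$, $$P^D_tf(x)=\mathbb E_x[f(X_t),\,t<\tau_D],\qquad R^D_\alpha f(x)=\int_0^\infty e^{-\alpha t}P^D_tf(x)\,dt,\qquad e_c(t)=\exp\Big\{-\int_0^tc(X_r)\,dr\Big\}.$$ Let $\mathcal S(D)=\bigcup_{x\in D}\big(x+\operatorname{supp}N(x,\cdot)\big)$, $D_S=D\cup\partial D\cup(\mathcal S(D)\setminus D)$ and $\bar u_{D_S}=\sup_{D_S}u$.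 A *weak subsolution* of $(-A+c)v=g$ in $D$ is a bounded Borel $u:\mathbb R^d\to\mathbb R$ such that for all $x\in D$, $t\ge0$, $$u(x)\le\mathbb E_x\big[e_c(\tau_D\wedge t)\,u(X_{\tau_D\wedge t})\big]+\mathbb E_x\Big[\int_0^{\tau_D\wedge t}e_c(r)\,g(X_r)\,dr\Big].$$ Let $\mathcal U_c(g)$ be the set of weak subsolutions and $\mathcal U_c^+(g)=\{u\in\mathcal U_c(g):\bar u_{D_S}\ge0\}$. Let $m$ be a non-trivial $\sigma$-finite Borel measure on $D$. Assume the minorization condition $M'(\bar c,\nu)$: there are $\lambda_D\ge0$ and a Borel function $\varphi_D:D\to[0,\infty)$ with $\int_D\varphi_D\,dm>0$ and $P^D_t\varphi_D=e^{-\lambda_Dt}\varphi_D$ on $D$ for all $t\ge0$, and $\nu$ is a non-trivial Borel measure on $D$ such that $$R^D_{\bar c}f(x)\ge\varphi_D(x)\int_Df\,d\nu,\qquad x\in D,$$ for every bounded non-negative Borel $f$ on $D$. **Corollary.** 1. If $\operatorname{supp}\nu=D$, then for every $u\in\mathcal U_c^+(g)$ that is continuous and non-constant in $D$ there is $a>0$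 such that $\bar u_{D_S}-u(x)\ge a\,\varphi_D(x)$ for all $x\in D$. 2. If $m\ll\nu$, then for every $u\in\mathcal U_c^+(g)$ that is not $m$-a.e. constant in $D$ there is $a>0$ such that $\bar u_{D_S}-u(x)\ge a\,\varphi_D(x)$ for all $x\in D$. 3. If $m\ll\nu$ and $\int_Dc\,dm>0$, then there is a constant $a>0$ such that for every $u\in\mathcal U_c(g)$ we have $\bar u_{D_S}-u(x)\ge a\,\bar u_{D_S}\,\varphi_D(x)$ for all $x\in D$. -/

import Mathlib

open MeasureTheory ProbabilityTheory Filter Topology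
open scoped NNReal ENNReal

noncomputable section

namespace LevyHopf

/-! ### The integro-differential operator -/

/-- The space `ℝ^d` with its Euclidean norm. -/
abbrev Space (d : ℕ) : Type := EuclideanSpace ℝ (Fin d)

/-- The coefficients of the operator: the diffusion matrix `Q`, the drift `b`, and the Levy kernel
`N(x, dy)` (a Borel measure for every `x`, depending measurably on `x`). -/
structure Coeffs (d : ℕ) where
  Q : Space d → Matrix (Fin d) (Fin d) ℝ
  b : Space d → Space d
  N : Kernel (Space d) (Space d)

variable {d : ℕ}

/-- `A u (x) = ½ Tr(Q(x) ∇²u(x)) + b(x)·∇u(x) + ∫ (u(x+y) - u(x) - y·∇u(x)/(1+|y|²)) N(x,dy)`. -/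
def Coeffs.op (a : Coeffs d) (u : Space d → ℝ) (x : Space d) : ℝ :=
  (1 / 2) * (∑ i, ∑ j, a.Q x i j *
      fderiv ℝ (fderiv ℝ u) x (EuclideanSpace.single i 1) (EuclideanSpace.single j 1))
    + fderiv ℝ u x (a.b x)
    + ∫ y, (u (x + y) - u x - fderiv ℝ u x y / (1 + ‖y‖ ^ 2)) ∂(a.N x)

/-- The coefficients `q_{ij}`, `b_j` are Borel, they are bounded on `D`, and `Q(x)` is non-negative
definite for each `x ∈ D`. -/
structure Coeffs.Local (a : Coeffs d) (D : Set (Space d)) : Prop where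
  measurable_Q : ∀ i j, Measurable fun x => a.Q x i j
  measurable_b : Measurable a.b
  bounded_Q : ∃ C : ℝ, ∀ x ∈ D, ∀ i j, |a.Q x i j| ≤ C
  bounded_b : ∃ C : ℝ, ∀ x ∈ D, ‖a.b x‖ ≤ C
  nonneg_Q : ∀ x ∈ D, ∀ ξ : Fin d → ℝ, 0 ≤ ∑ i, ∑ j, a.Q x i j * ξ i * ξ j

/-- `N(x, ·)` is a measure on `ℝ^d ∖ {0}` and `sup_x ∫ min(1, |y|²) N(x, dy) < ∞`.
(In particular `N(x, ·)` is `σ`-finite.) -/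
structure Coeffs.Levy (a : Coeffs d) : Prop where
  zero : ∀ x, a.N x {0} = 0
  bounded : ∃ C : ℝ≥0, ∀ x, ∫⁻ y, ENNReal.ofReal (min 1 (‖y‖ ^ 2)) ∂(a.N x) ≤ C

/-- The range of non-locality `𝒮(D) = ⋃_{x ∈ D} (x + supp N(x, ·))`. -/
def Coeffs.nonlocalRange (a : Coeffs d) (D : Set (Space d)) : Set (Space d) :=
  ⋃ x ∈ D, (fun y => x + y) '' (a.N x).support

/-- The extended boundary `∂_S D = ∂D ∪ (𝒮(D) ∖ D)`. -/
def Coeffs.extBoundary (a : Coeffs d) (D : Set (Space d)) : Set (Space d) :=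
  frontier D ∪ (a.nonlocalRange D \ D)

/-- `D_S = ∂_S D ∪ D`. -/
def Coeffs.extDomain (a : Coeffs d) (D : Set (Space d)) : Set (Space d) :=
  a.extBoundary D ∪ D

/-! ### Path space -/

/-- Right continuous functions `[0, ∞) → ℝ^d` with left limits in `ℝ^d`, with the `σ`-algebra
generated by the coordinates (which is the Borel `σ`-algebra of the Skorokhod topology). -/
abbrev Path (d : ℕ) : Type :=
  {ω : ℝ≥0 → Space d // ∀ t, ContinuousWithinAt ω (Set.Ici t) t ∧ ∃ l, Tendsto ω (𝓝[<] t) (𝓝 l)}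

/-- The canonical process. -/
def X (t : ℝ≥0) (ω : Path d) : Space d := ω.1 t

theorem measurable_X (t : ℝ≥0) : Measurable (X (d := d) t) :=
  (measurable_pi_apply t).comp measurable_subtype_coe

/-- The natural filtration of the canonical process. -/
def natFiltration (d : ℕ) : Filtration ℝ≥0 (inferInstance : MeasurableSpace (Path d)) :=
  Filtration.natural (fun t => X t) fun t => (measurable_X t).stronglyMeasurable

/-- The shift `θ_s ω = ω(s + ·)`. -/
def shift (s : ℝ≥0) (ω : Path d) : Path d :=
  ⟨fun t => ω.1 (s + t), fun t => by
    refine ⟨?_, ?_⟩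
    · refine (ω.2 (s + t)).1.comp (continuous_const.add continuous_id).continuousWithinAt ?_
      intro r hr
      exact add_le_add le_rfl (Set.mem_Ici.mp hr)
    · obtain ⟨l, hl⟩ := (ω.2 (s + t)).2
      refine ⟨l, hl.comp ?_⟩
      refine tendsto_nhdsWithin_of_tendsto_nhds_of_eventually_within _ ?_ ?_
      · exact ((continuous_const.add continuous_id).tendsto t).mono_left nhdsWithin_le_nhds
      · filter_upwards [self_mem_nhdsWithin] with r hr
        exact add_lt_add_of_le_of_lt le_rfl (Set.mem_Iio.mp hr)⟩

/-! ### The martingale problem -/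

/-- `C²` functions on `ℝ^d` that are bounded together with their first two derivatives. -/
def IsCb2 (f : Space d → ℝ) : Prop :=
  ContDiff ℝ 2 f ∧
    ∃ C : ℝ, ∀ x, |f x| ≤ C ∧ ‖fderiv ℝ f x‖ ≤ C ∧ ‖fderiv ℝ (fderiv ℝ f) x‖ ≤ C

/-- `M_t[f] = f(X_t) - f(X_0) - ∫_0^t A f(X_r) dr`. -/
def Coeffs.mgPath (a : Coeffs d) (f : Space d → ℝ) (t : ℝ≥0) (ω : Path d) : ℝ :=
  f (X t ω) - f (X 0 ω) - ∫ r in (0 : ℝ)..t, a.op f (X r.toNNReal ω)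

/-- Solutions of the martingale problem for the operator, with initial law `μ`. The condition
`integrable` only says that the time integral in `M_t[f]` exists; it is automatic for coefficients
that are bounded on the whole of `ℝ^d`. -/
structure Coeffs.SolvesMP (a : Coeffs d) (μ : Measure (Space d)) (Pμ : Measure (Path d)) :
    Prop where
  prob : IsProbabilityMeasure Pμ
  initial : Pμ.map (X 0) = μ
  integrable : ∀ f, IsCb2 f → ∀ t : ℝ≥0,
    ∀ᵐ ω ∂Pμ, IntervalIntegrable (fun r : ℝ => a.op f (X r.toNNReal ω)) volume 0 t
  martingale : ∀ f, IsCb2 f → Martingale (a.mgPath f) (natFiltration d) Pμ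

/-- Strong Markovian solutions `(P_x)` of the martingale problem. Measurability of
`x ↦ P_x[C]` is part of the notion of a kernel. -/
structure Coeffs.IsStrongMarkovSolution (a : Coeffs d) (P : Kernel (Space d) (Path d)) :
    Prop where
  solves : ∀ x, a.SolvesMP (Measure.dirac x) (P x)
  /-- `P_x[A ∩ {θ_τ ∈ B}] = E_x[P_{X_τ}[B]; A]` for each stopping time `τ` and each
  `A ∈ ℱ_τ` with `A ⊆ {τ < ∞}`. -/
  strongMarkov : ∀ (x : Space d) (τ : Path d → WithTop ℝ≥0)
    (hτ : IsStoppingTime (natFiltration d) τ) (A : Set (Path d)),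
    MeasurableSet[hτ.measurableSpace] A → (∀ ω ∈ A, τ ω ≠ ⊤) →
    ∀ B : Set (Path d), MeasurableSet B →
      P x (A ∩ {ω | shift ((τ ω).untopD 0) ω ∈ B})
        = ∫⁻ ω in A, P (X ((τ ω).untopD 0) ω) B ∂(P x)
  mixture : ∀ μ : Measure (Space d), IsProbabilityMeasure μ → a.SolvesMP μ (μ.bind P)

/-! ### Exit time, semigroup, resolvent -/

/-- `τ_D = inf {t > 0 : X_t ∉ D}`, with `inf ∅ = ∞`. -/
def exitTime (D : Set (Space d)) (ω : Path d) : ℝ≥0∞ :=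
  ⨅ (t : ℝ≥0) (_ : 0 < t ∧ X t ω ∉ D), (t : ℝ≥0∞)

/-- `τ_D ∧ t`. -/
def exitMin (D : Set (Space d)) (t : ℝ≥0) (ω : Path d) : ℝ≥0 :=
  (min (exitTime D ω) t).toNNReal

/-- The exit time from `D` is finite, `P_x`-almost surely, for each `x ∈ D`. -/
def FiniteExit (P : Kernel (Space d) (Path d)) (D : Set (Space d)) : Prop :=
  ∀ x ∈ D, ∀ᵐ ω ∂(P x), exitTime D ω < ∞

/-- `P^D_t f(x) = E_x[f(X_t), t < τ_D]` for `f ≥ 0`, as an element of `[0, ∞]`. -/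
def semigroup (P : Kernel (Space d) (Path d)) (D : Set (Space d)) (t : ℝ≥0) (f : Space d → ℝ)
    (x : Space d) : ℝ≥0∞ :=
  ∫⁻ ω, {ω | (t : ℝ≥0∞) < exitTime D ω}.indicator (fun ω => ENNReal.ofReal (f (X t ω))) ω ∂(P x)

/-- `R^D_α f(x) = ∫_0^∞ e^{-αt} P^D_t f(x) dt` for `f ≥ 0`, as an element of `[0, ∞]`. -/
def resolvent (P : Kernel (Space d) (Path d)) (D : Set (Space d)) (α : ℝ) (f : Space d → ℝ)
    (x : Space d) : ℝ≥0∞ :=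
  ∫⁻ t in Set.Ioi (0 : ℝ), ENNReal.ofReal (Real.exp (-α * t)) * semigroup P D t.toNNReal f x

/-! Functions on `D` are represented by functions on `ℝ^d` whose values off `D` play no role, and
measures on `D` by restrictions to `D` of measures on `ℝ^d`. -/

/-- Bounded non-negative Borel functions on `D`. -/
structure BddNonnegBorel (D : Set (Space d)) (f : Space d → ℝ) : Prop where
  measurable : Measurable fun x : D => f x
  nonneg : ∀ x ∈ D, 0 ≤ f x
  bounded : ∃ C : ℝ, ∀ x ∈ D, f x ≤ C

/-- `(φ, lam)` is a non-negative eigenfunction and eigenvalue: `φ : D → [0, ∞)` is Borel,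
`lam ≥ 0`, `e^{-lam t} φ = P^D_t φ` on `D` for `t ≥ 0`, and `∫_D φ dm > 0`. -/
structure IsEigen (P : Kernel (Space d) (Path d)) (D : Set (Space d)) (m : Measure (Space d))
    (φ : Space d → ℝ) (lam : ℝ) : Prop where
  measurable : Measurable fun x : D => φ x
  nonneg : ∀ x ∈ D, 0 ≤ φ x
  eigenvalue_nonneg : 0 ≤ lam
  eigen : ∀ t : ℝ≥0, ∀ x ∈ D,
    ENNReal.ofReal (Real.exp (-lam * t) * φ x) = semigroup P D t φ x
  integral_pos : 0 < ∫⁻ x in D, ENNReal.ofReal (φ x) ∂m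

/-- The minorization condition by the eigenfunction: `φ` is a non-negative eigenfunction, `ν` is a
non-trivial Borel measure on `D`, and `R^D_α f ≥ φ ∫_D f dν` on `D` for each bounded non-negative
Borel function `f` on `D`. -/
structure EigenMinorization (P : Kernel (Space d) (Path d)) (D : Set (Space d))
    (m : Measure (Space d)) (φ : Space d → ℝ) (lam : ℝ) (α : ℝ) (ν : Measure (Space d)) :
    Prop where
  isEigen : IsEigen P D m φ lam
  nontrivial : ν D ≠ 0
  minorization : ∀ f, BddNonnegBorel D f → ∀ x ∈ D,
    ENNReal.ofReal (φ x) * ∫⁻ y in D, ENNReal.ofReal (f y) ∂ν ≤ resolvent P D α f x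

/-! ### Weak subsolutions -/

/-- `sup_B f`. -/
def supOn (B : Set (Space d)) (f : Space d → ℝ) : ℝ := sSup (f '' B)

/-- `e_c(t) = exp(-∫_0^t c(X_r) dr)`. -/
def discount (c : Space d → ℝ) (t : ℝ≥0) (ω : Path d) : ℝ :=
  Real.exp (-∫ r in (0 : ℝ)..t, c (X r.toNNReal ω))

/-- `E_x ∫_0^{τ_D ∧ t} e_c(r) g⁻(X_r) dr ∈ [0, ∞]`; for `g ≤ 0` this is
`-E_x ∫_0^{τ_D ∧ t} e_c(r) g(X_r) dr`. -/
def sourceTerm (P : Kernel (Space d) (Path d)) (D : Set (Space d)) (c g : Space d → ℝ)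
    (t : ℝ≥0) (x : Space d) : ℝ≥0∞ :=
  ∫⁻ ω, (∫⁻ r in Set.Ioc (0 : ℝ) (exitMin D t ω),
    ENNReal.ofReal (discount c r.toNNReal ω * -g (X r.toNNReal ω))) ∂(P x)

/-- Weak subsolutions of `(-A + c) v = g` in `D`, for `g ≤ 0`: bounded Borel functions `u` on `ℝ^d`
with `u(x) ≤ E_x[e_c(τ_D ∧ t) u(X_{τ_D ∧ t})] + E_x ∫_0^{τ_D ∧ t} e_c(r) g(X_r) dr` for `x ∈ D`,
`t ≥ 0`. The last term takes values in `[-∞, 0]`, and the inequality forces it to be finite. -/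
structure IsWeakSubsolution (P : Kernel (Space d) (Path d)) (D : Set (Space d))
    (c g : Space d → ℝ) (u : Space d → ℝ) : Prop where
  measurable : Measurable u
  bounded : ∃ C : ℝ, ∀ x, |u x| ≤ C
  source_finite : ∀ x ∈ D, ∀ t : ℝ≥0, sourceTerm P D c g t x ≠ ∞
  le : ∀ x ∈ D, ∀ t : ℝ≥0,
    u x ≤ (∫ ω, discount c (exitMin D t ω) ω * u (X (exitMin D t ω) ω) ∂(P x))
      - (sourceTerm P D c g t x).toReal

end LevyHopf

end

/-!
The function `v = sup u - u` (supremum over the extended domain) satisfies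
`v ≥ e^{-αt} P^D_t v` on `D` with `α = sup c`, and the minorization condition bounds resolvents from
below by multiples of `φ`. So it suffices to place below `v` a resolvent `R^D_α f` with `f` charged
by `ν`.

*Domination* (`lintegral_killed_levelSource_le`). Let `q_j = P^D_j 1 - P^D_{j+1} 1` be the
probability of leaving `D` between the times `j` and `j + 1`. Since `∑_k P^D_k q_j` telescopes to a
quantity at most `1`, the function `f = δ 1_{v ≥ δ} q_j` has `∑_k e^{-αk} P^D_k f ≤ δ ≤ v` on
`{v ≥ δ}`; where `f` vanishes, the partial sums are carried over by the semigroup, so they stay below `v`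
everywhere. Averaging over the offsets in `(0, 1]` gives `R^D_α f ≤ v`. As the exit time is finite,
the `q_j` sum to `1`, so some `f` of this form has positive `ν`-integral unless `v = 0` holds `ν`-almost
everywhere on `D`. If `c` is not trivial, then directly `v ≥ (sup u) E[1 - e_c] ≥ ½ (sup u) R^D_α c`
(`resolvent_le_sup_sub`), with a constant that does not depend on `u`.

*Exit time.* The inequality for `v` needs two facts about the path, both of which follow from
Dynkin's formula (`dynkin`), that is, from optional sampling for the martingale problem. The exit
time is not a stopping time of the natural filtration, because the path could have a left limit in
the complement of `D` without leaving `D`; the contact time `reach D 0`, which includes left limits,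
is one. Comparing Dynkin's formula at the contact time and at the first times of distance at most
`1 / (n + 1)` shows that the path is outside `D` at the contact time (`ae_notMem_of_contact`), so
that the two times agree almost surely. Applied to bump functions supported away from `D`, for which
only the jump part of the operator remains on `D`, the formula shows that the path leaves `D` into
the extended domain up to a null set (`measure_landing_isCompact`, `ae_le_supOn`).
-/

namespace LevyHopf

section

variable {d : ℕ}

/-! ### Distance to the complement along a path -/

/-- The distance of a point to the complement of `D`. -/
noncomputable def gap (D : Set (Space d)) (x : Space d) : ℝ := Metric.infDist x Dᶜ

/-- The running infimum of the distance to `Dᶜ`. It vanishes as soon as the path or one of its left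
limits has reached `Dᶜ`. -/
noncomputable def runMin (D : Set (Space d)) (t : ℝ≥0) (ω : Path d) : ℝ :=
  ⨅ s : Set.Iic t, gap D (X s ω)

/-- The first time at which the running distance to `Dᶜ` is at most `ε`. Unlike `exitTime`, it is a
stopping time of the natural filtration, since left limits of the path are taken into account. -/
noncomputable def reach (D : Set (Space d)) (ε : ℝ) (ω : Path d) : ℝ≥0∞ :=
  ⨅ (t : ℝ≥0) (_ : runMin D t ω ≤ ε), (t : ℝ≥0∞)

/-- The time `reach D ε` capped at `t`. -/
noncomputable def stopAt (D : Set (Space d)) (ε : ℝ) (t : ℝ≥0) (ω : Path d) : ℝ≥0 :=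
  (min (reach D ε ω) t).toNNReal

variable {D : Set (Space d)}

theorem gap_nonneg (x : Space d) : 0 ≤ gap D x := Metric.infDist_nonneg

theorem continuous_gap : Continuous (gap D) := Metric.continuous_infDist_pt _

theorem gap_of_notMem {x : Space d} (hx : x ∉ D) : gap D x = 0 :=
  Metric.infDist_zero_of_mem hx

theorem mem_of_gap_pos {x : Space d} (hx : 0 < gap D x) : x ∈ D := by
  by_contra h
  exact hx.ne' (gap_of_notMem h)

theorem gap_pos (hD : IsOpen D) (hD' : Dᶜ.Nonempty) {x : Space d} (hx : x ∈ D) : 0 < gap D x :=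
  (hD.isClosed_compl.notMem_iff_infDist_pos hD').1 fun h => h hx

theorem continuousWithinAt_X (t : ℝ≥0) (ω : Path d) :
    ContinuousWithinAt (fun s => X s ω) (Set.Ici t) t := (ω.2 t).1

theorem bddBelow_gap (t : ℝ≥0) (ω : Path d) :
    BddBelow (Set.range fun s : Set.Iic t => gap D (X s ω)) :=
  ⟨0, by rintro _ ⟨s, rfl⟩; exact gap_nonneg _⟩

theorem runMin_le {s t : ℝ≥0} (h : s ≤ t) (ω : Path d) : runMin D t ω ≤ gap D (X s ω) :=
  ciInf_le (bddBelow_gap t ω) (⟨s, h⟩ : Set.Iic t)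

theorem le_runMin {t : ℝ≥0} {ω : Path d} {η : ℝ} (h : ∀ s ≤ t, η ≤ gap D (X s ω)) :
    η ≤ runMin D t ω := by
  have : Nonempty (Set.Iic t) := ⟨⟨t, Set.mem_Iic.2 le_rfl⟩⟩
  exact le_ciInf fun s => h s.1 s.2

theorem runMin_anti {s t : ℝ≥0} (h : s ≤ t) (ω : Path d) : runMin D t ω ≤ runMin D s ω :=
  le_runMin fun _ hr => runMin_le (hr.trans h) ω

theorem runMin_lt_iff {t : ℝ≥0} {ω : Path d} {η : ℝ} :
    runMin D t ω < η ↔ ∃ s ≤ t, gap D (X s ω) < η := by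
  constructor
  · intro h
    by_contra! h'
    exact absurd (le_runMin h') (not_le.2 h)
  · rintro ⟨s, hs, h⟩
    exact (runMin_le hs ω).trans_lt h

/-- Right continuity of the running infimum. -/
theorem exists_gt_lt_runMin {t : ℝ≥0} {ω : Path d} {η : ℝ} (h : η < runMin D t ω) :
    ∃ u > t, η < runMin D u ω := by
  obtain ⟨η', h1, h2⟩ := exists_between h
  have hc : ContinuousWithinAt (fun s => gap D (X s ω)) (Set.Ici t) t :=
    continuous_gap.continuousAt.comp_continuousWithinAt (continuousWithinAt_X t ω)
  have hev : ∀ᶠ s in 𝓝[≥] t, η' < gap D (X s ω) :=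
    hc.eventually_const_lt (h2.trans_le (runMin_le le_rfl ω))
  obtain ⟨u, hu, hsub⟩ := mem_nhdsGE_iff_exists_Icc_subset.1 hev
  refine ⟨u, hu, h1.trans_le (le_runMin fun s hs => ?_)⟩
  rcases le_total s t with hst | hst
  · exact h2.le.trans (runMin_le hst ω)
  · exact (hsub ⟨hst, hs⟩).le

theorem lt_reach_iff {t : ℝ≥0} {ω : Path d} {ε : ℝ} :
    (t : ℝ≥0∞) < reach D ε ω ↔ ε < runMin D t ω := by
  constructor
  · intro h
    by_contra! h'
    exact absurd (iInf₂_le t h') (not_le.2 h)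
  · intro h
    obtain ⟨u, hu, h'⟩ := exists_gt_lt_runMin h
    refine (ENNReal.coe_lt_coe.2 hu).trans_le (le_iInf₂ fun s hs => ?_)
    by_contra! hlt
    exact absurd (h'.trans_le (runMin_anti (ENNReal.coe_lt_coe.1 hlt).le ω)) (not_lt.2 hs)

theorem reach_le_iff {t : ℝ≥0} {ω : Path d} {ε : ℝ} :
    reach D ε ω ≤ t ↔ runMin D t ω ≤ ε := by
  rw [← not_lt, lt_reach_iff, not_lt]

theorem coe_stopAt (ε : ℝ) (t : ℝ≥0) (ω : Path d) :
    (stopAt D ε t ω : ℝ≥0∞) = min (reach D ε ω) t :=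
  ENNReal.coe_toNNReal (ne_top_of_le_ne_top ENNReal.coe_ne_top (min_le_right _ _))

theorem stopAt_le (ε : ℝ) (t : ℝ≥0) (ω : Path d) : stopAt D ε t ω ≤ t := by
  rw [← ENNReal.coe_le_coe, coe_stopAt]
  exact min_le_right _ _

theorem stopAt_le_iff {ε : ℝ} {s t : ℝ≥0} {ω : Path d} :
    stopAt D ε t ω ≤ s ↔ runMin D s ω ≤ ε ∨ t ≤ s := by
  rw [← ENNReal.coe_le_coe, coe_stopAt, min_le_iff, reach_le_iff, ENNReal.coe_le_coe]

theorem lt_runMin_of_lt_stopAt {ε : ℝ} {s t : ℝ≥0} {ω : Path d} (h : s < stopAt D ε t ω) :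
    ε < runMin D s ω := by
  by_contra! h'
  exact absurd (stopAt_le_iff.2 (Or.inl h')) (not_le.2 h)

theorem mem_of_lt_stopAt {ε : ℝ} (hε : 0 ≤ ε) {s t : ℝ≥0} {ω : Path d}
    (h : s < stopAt D ε t ω) : X s ω ∈ D :=
  mem_of_gap_pos ((hε.trans_lt (lt_runMin_of_lt_stopAt h)).trans_le (runMin_le le_rfl ω))

theorem stopAt_eq_right {ε : ℝ} {t : ℝ≥0} {ω : Path d} (h : ε < runMin D t ω) :
    stopAt D ε t ω = t := by
  rw [← ENNReal.coe_inj, coe_stopAt, min_eq_right (lt_reach_iff.2 h).le]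

theorem runMin_stopAt_le {ε : ℝ} {t : ℝ≥0} {ω : Path d} (h : runMin D t ω ≤ ε) :
    runMin D (stopAt D ε t ω) ω ≤ ε := by
  rw [← reach_le_iff, coe_stopAt, min_eq_left (reach_le_iff.2 h)]

theorem stopAt_anti {ε ε' : ℝ} (h : ε ≤ ε') (t : ℝ≥0) (ω : Path d) :
    stopAt D ε' t ω ≤ stopAt D ε t ω := by
  rw [stopAt_le_iff]
  rcases le_or_gt (runMin D t ω) ε with h1 | h1
  · exact Or.inl ((runMin_stopAt_le h1).trans h)
  · exact Or.inr (stopAt_eq_right h1).ge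

/-! ### Measurability -/

theorem measurable_X_of_le {s t : ℝ≥0} (h : s ≤ t) :
    Measurable[natFiltration d t] (X (d := d) s) := by
  have h1 : StronglyMeasurable[natFiltration d s] (X (d := d) s) :=
    Filtration.stronglyAdapted_natural (fun t => (measurable_X t).stronglyMeasurable) s
  exact h1.measurable.mono ((natFiltration d).mono h) le_rfl

/-- The infimum over `[0, t]` is decided by a countable set of times, by right continuity. -/
theorem measurableSet_runMin_lt (t : ℝ≥0) (η : ℝ) :
    MeasurableSet[natFiltration d t] {ω | runMin D t ω < η} := by
  obtain ⟨S, hSc, hSd⟩ := TopologicalSpace.exists_countable_dense ℝ≥0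
  have key : {ω : Path d | runMin D t ω < η} =
      {ω | gap D (X t ω) < η} ∪ ⋃ q ∈ S ∩ Set.Iic t, {ω | gap D (X q ω) < η} := by
    ext ω
    simp only [Set.mem_ofPred_eq, Set.mem_union, Set.mem_iUnion, runMin_lt_iff]
    constructor
    · rintro ⟨s, hs, h⟩
      rcases hs.eq_or_lt with rfl | hst
      · exact Or.inl h
      right
      have hc : ContinuousWithinAt (fun s => gap D (X s ω)) (Set.Ici s) s :=
        continuous_gap.continuousAt.comp_continuousWithinAt (continuousWithinAt_X s ω)
      have hev : ∀ᶠ r in 𝓝[≥] s, gap D (X r ω) < η := hc.eventually_lt_const h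
      obtain ⟨u, hu, hsub⟩ := mem_nhdsGE_iff_exists_Icc_subset.1 hev
      obtain ⟨q, hqS, hq⟩ := hSd.exists_between (lt_min hu hst)
      exact ⟨q, ⟨hqS, (hq.2.trans_le (min_le_right _ _)).le⟩,
        hsub ⟨hq.1.le, (hq.2.trans_le (min_le_left _ _)).le⟩⟩
    · rintro (h | ⟨q, hq, h⟩)
      · exact ⟨t, le_rfl, h⟩
      · exact ⟨q, hq.2, h⟩
  have hm : ∀ q ≤ t, MeasurableSet[natFiltration d t] {ω : Path d | gap D (X q ω) < η} :=
    fun q hq => (continuous_gap.measurable.comp (measurable_X_of_le hq)) measurableSet_Iio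
  rw [key]
  exact (hm t le_rfl).union (MeasurableSet.biUnion (hSc.mono Set.inter_subset_left)
    fun q hq => hm q hq.2)

theorem measurable_runMin (t : ℝ≥0) : Measurable[natFiltration d t] (runMin D t) :=
  measurable_of_Iio fun η => measurableSet_runMin_lt t η

theorem measurable_reach (ε : ℝ) : Measurable (reach D ε) := by
  refine measurable_of_Iio fun a => ?_
  have : reach D ε ⁻¹' Set.Iio a =
      ⋃ q : {q : ℚ // 0 ≤ q ∧ ENNReal.ofReal q < a}, {ω | reach D ε ω ≤ ENNReal.ofReal q.1} := by
    ext ω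
    simp only [Set.mem_preimage, Set.mem_Iio, Set.mem_iUnion, Set.mem_ofPred_eq]
    constructor
    · intro h
      obtain ⟨q, h0, h1, h2⟩ := ENNReal.lt_iff_exists_rat_btwn.1 h
      exact ⟨⟨q, h0, h2⟩, h1.le⟩
    · rintro ⟨q, hq⟩
      exact hq.trans_lt q.2.2
  rw [this]
  refine MeasurableSet.iUnion fun q => ?_
  have h2 : {ω : Path d | reach D ε ω ≤ ENNReal.ofReal q.1} =
      {ω | runMin D (Real.toNNReal q.1) ω ≤ ε} := by
    ext ω
    exact reach_le_iff
  rw [h2]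
  exact ((measurable_runMin _).mono ((natFiltration d).le _) le_rfl) measurableSet_Iic

theorem measurable_stopAt (ε : ℝ) (t : ℝ≥0) : Measurable (stopAt (d := d) D ε t) :=
  ((measurable_reach ε).min measurable_const).ennreal_toNNReal

/-- The grid times `⌈(n + 1) s⌉ / (n + 1)`, which approximate `s` from above. -/
noncomputable def gridTime (n : ℕ) (s : ℝ≥0) : ℝ≥0 := ⌈((n : ℝ≥0) + 1) * s⌉₊ / ((n : ℝ≥0) + 1)

theorem le_gridTime (n : ℕ) (s : ℝ≥0) : s ≤ gridTime n s := by
  rw [gridTime, le_div_iff₀ (by positivity), mul_comm]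
  exact Nat.le_ceil _

theorem gridTime_le_iff {n : ℕ} {s t : ℝ≥0} :
    gridTime n s ≤ t ↔ s ≤ ⌊((n : ℝ≥0) + 1) * t⌋₊ / ((n : ℝ≥0) + 1) := by
  have hn : (0 : ℝ≥0) < (n : ℝ≥0) + 1 := by positivity
  rw [gridTime, div_le_iff₀ hn, le_div_iff₀ hn, mul_comm t, mul_comm s,
    ← Nat.le_floor_iff (by positivity), Nat.ceil_le]

theorem floor_grid_le (n : ℕ) (t : ℝ≥0) : ⌊((n : ℝ≥0) + 1) * t⌋₊ / ((n : ℝ≥0) + 1) ≤ t := by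
  rw [div_le_iff₀ (by positivity), mul_comm t]
  exact Nat.floor_le (by positivity)

theorem tendsto_gridTime (s : ℝ≥0) : Tendsto (fun n => gridTime n s) atTop (𝓝 s) := by
  have h : Tendsto (fun n : ℕ => s + 1 / ((n : ℝ≥0) + 1)) atTop (𝓝 s) := by
    simpa using tendsto_const_nhds.add (tendsto_one_div_add_atTop_nhds_zero_nat (𝕜 := ℝ≥0))
  refine tendsto_of_tendsto_of_tendsto_of_le_of_le tendsto_const_nhds h
    (fun n => le_gridTime n s) fun n => ?_
  have hn : (0 : ℝ≥0) < (n : ℝ≥0) + 1 := by positivity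
  have h1 := (Nat.ceil_lt_add_one (show (0 : ℝ≥0) ≤ ((n : ℝ≥0) + 1) * s by positivity)).le
  calc gridTime n s ≤ (((n : ℝ≥0) + 1) * s + 1) / ((n : ℝ≥0) + 1) := by
        unfold gridTime; gcongr
    _ = s + 1 / ((n : ℝ≥0) + 1) := by field_simp

theorem tendsto_gridTime_within (s : ℝ≥0) :
    Tendsto (fun n => gridTime n s) atTop (𝓝[≥] s) :=
  tendsto_nhdsWithin_iff.2 ⟨tendsto_gridTime s, .of_forall fun n => le_gridTime n s⟩

theorem countable_range_gridTime (n : ℕ) : (Set.range (gridTime n)).Countable := by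
  refine (Set.countable_range fun k : ℕ => (k : ℝ≥0) / ((n : ℝ≥0) + 1)).mono ?_
  rintro _ ⟨s, rfl⟩
  exact ⟨_, rfl⟩

/-- Joint measurability of the canonical process, from right continuity. -/
theorem measurable_X_uncurry : Measurable fun p : ℝ≥0 × Path d => X p.1 p.2 := by
  refine measurable_of_tendsto_metrizable
    (f := fun (n : ℕ) (p : ℝ≥0 × Path d) => X (gridTime n p.1) p.2) (fun n => ?_) ?_
  · have h1 : Measurable fun p : ℕ × Path d => X ((p.1 : ℝ≥0) / ((n : ℝ≥0) + 1)) p.2 :=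
      measurable_from_prod_countable_right fun k => measurable_X ((k : ℝ≥0) / ((n : ℝ≥0) + 1))
    have h2 : Measurable fun p : ℝ≥0 × Path d => (⌈((n : ℝ≥0) + 1) * p.1⌉₊, p.2) :=
      (Nat.measurable_ceil.comp (measurable_const.mul measurable_fst)).prodMk measurable_snd
    exact h1.comp h2
  · rw [tendsto_pi_nhds]
    intro p
    exact (continuousWithinAt_X p.1 p.2).tendsto.comp (tendsto_gridTime_within p.1)

theorem measurable_X_comp {σ : Path d → ℝ≥0} (hσ : Measurable σ) :
    Measurable fun ω => X (σ ω) ω :=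
  measurable_X_uncurry.comp (hσ.prodMk measurable_id)

theorem measurable_shift (s : ℝ≥0) : Measurable (shift (d := d) s) := by
  refine Measurable.subtype_mk (measurable_pi_lambda _ fun t => ?_)
  exact measurable_X (s + t)

theorem runMin_add (s t : ℝ≥0) (ω : Path d) :
    runMin D (s + t) ω = min (runMin D s ω) (runMin D t (shift s ω)) := by
  refine le_antisymm (le_min (runMin_anti le_self_add ω) (le_runMin fun r hr => ?_))
    (le_runMin fun r hr => ?_)
  · exact runMin_le (add_le_add le_rfl hr) ω
  · rcases le_total r s with h | h
    · exact (min_le_left _ _).trans (runMin_le h ω)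
    · obtain ⟨q, rfl⟩ := exists_add_of_le h
      exact (min_le_right _ _).trans (runMin_le (add_le_add_iff_left s |>.1 hr) (shift s ω))

end

section

variable {d : ℕ}

/-! ### Optional sampling in continuous time -/

/-- Optional sampling at a bounded stopping time. Approximate the stopping time from above by
stopping times with countable range: the sampled values are conditional expectations of `M t`, hence
uniformly integrable, and converge by right continuity. -/
theorem integral_stopped_eq {Ω : Type*} {mΩ : MeasurableSpace Ω} {μ : Measure Ω}
    [IsProbabilityMeasure μ] {ℱ : Filtration ℝ≥0 mΩ} {M : ℝ≥0 → Ω → ℝ} (hM : Martingale M ℱ μ)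
    {σ : Ω → ℝ≥0} (hσ : ∀ s, MeasurableSet[ℱ s] {ω | σ ω ≤ s}) {t : ℝ≥0} (hσt : ∀ ω, σ ω ≤ t)
    (hrc : ∀ᵐ ω ∂μ, ContinuousWithinAt (fun s => M s ω) (Set.Icc (σ ω) t) (σ ω)) :
    Integrable (fun ω => M (σ ω) ω) μ ∧ ∫ ω, M (σ ω) ω ∂μ = ∫ ω, M t ω ∂μ := by
  let σn : ℕ → Ω → ℝ≥0 := fun n ω => min (gridTime n (σ ω)) t
  have hst : ∀ n, IsStoppingTime ℱ fun ω => (σn n ω : WithTop ℝ≥0) := by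
    intro n s
    have : {ω | (σn n ω : WithTop ℝ≥0) ≤ s} =
        {ω | σ ω ≤ ⌊((n : ℝ≥0) + 1) * s⌋₊ / ((n : ℝ≥0) + 1)} ∪ {_ω | t ≤ s} := by
      ext ω
      simp only [σn, Set.mem_ofPred_eq, WithTop.coe_le_coe, min_le_iff, gridTime_le_iff,
        Set.mem_union]
    rw [this]
    exact (ℱ.mono (floor_grid_le n s) _ (hσ _)).union (MeasurableSet.const _)
  have hle : ∀ n ω, (σn n ω : WithTop ℝ≥0) ≤ (t : WithTop ℝ≥0) :=
    fun n ω => WithTop.coe_le_coe.2 (min_le_right _ _)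
  have hcount : ∀ n, (Set.range fun ω => (σn n ω : WithTop ℝ≥0)).Countable := by
    intro n
    refine ((countable_range_gridTime n).image fun s => ((min s t : ℝ≥0) : WithTop ℝ≥0)).mono ?_
    rintro _ ⟨ω, rfl⟩
    exact ⟨gridTime n (σ ω), ⟨_, rfl⟩, rfl⟩
  have hce : ∀ n, (fun ω => M (σn n ω) ω) =ᵐ[μ] μ[M t | (hst n).measurableSpace] := fun n =>
    hM.stoppedValue_ae_eq_condExp_of_le_const_of_countable_range (hst n) (hle n) (hcount n)
  have hui : UniformIntegrable (fun n ω => M (σn n ω) ω) 1 μ :=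
    ((hM.integrable t).uniformIntegrable_condExp fun n => (hst n).measurableSpace_le).ae_eq
      fun n => (hce n).symm
  have hlim : ∀ᵐ ω ∂μ, Tendsto (fun n => M (σn n ω) ω) atTop (𝓝 (M (σ ω) ω)) := by
    filter_upwards [hrc] with ω hω
    refine hω.tendsto.comp (tendsto_nhdsWithin_iff.2 ⟨?_, .of_forall fun n =>
      ⟨le_min (le_gridTime n _) (hσt ω), min_le_right _ _⟩⟩)
    have := (tendsto_gridTime (σ ω)).min (tendsto_const_nhds (x := t))
    rwa [min_eq_left (hσt ω)] at this
  have hmem : MemLp (fun ω => M (σ ω) ω) 1 μ := hui.memLp_of_ae_tendsto hlim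
  have hL := tendsto_Lp_finite_of_tendsto_ae le_rfl ENNReal.one_ne_top hui.1 hmem hui.2.1 hlim
  have hint : Integrable (fun ω => M (σ ω) ω) μ := memLp_one_iff_integrable.1 hmem
  refine ⟨hint, ?_⟩
  have hI : ∀ n, ∫ ω, M (σn n ω) ω ∂μ = ∫ ω, M t ω ∂μ := fun n => by
    rw [integral_congr_ae (hce n), integral_condExp]
  have hconv := tendsto_integral_of_L1' (fun ω => M (σ ω) ω) hint.1 (F := fun n ω => M (σn n ω) ω)
    (l := atTop) (.of_forall fun n => integrable_condExp.congr (hce n).symm) hL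
  simp only [hI] at hconv
  exact (tendsto_nhds_unique hconv tendsto_const_nhds)

/-! ### The operator on test functions -/

theorem min_one_sq_cases (r : ℝ) (hr : 0 ≤ r) :
    (r ≤ 1 ∧ min 1 (r ^ 2) = r ^ 2) ∨ (1 < r ∧ min 1 (r ^ 2) = 1) := by
  rcases le_or_gt r 1 with h | h
  · exact Or.inl ⟨h, min_eq_right (by nlinarith)⟩
  · exact Or.inr ⟨h, min_eq_left (by nlinarith)⟩

/-- The compensated increment of a `C_b²` function is `O(min(1, |y|²))`. -/
theorem abs_increment_le {f : Space d → ℝ} (hf : ContDiff ℝ 2 f) {C : ℝ}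
    (hC : ∀ x, |f x| ≤ C ∧ ‖fderiv ℝ f x‖ ≤ C ∧ ‖fderiv ℝ (fderiv ℝ f) x‖ ≤ C) (x y : Space d) :
    |f (x + y) - f x - fderiv ℝ f x y / (1 + ‖y‖ ^ 2)| ≤ 3 * C * min 1 (‖y‖ ^ 2) := by
  have hC0 : 0 ≤ C := (norm_nonneg _).trans (hC 0).2.1
  have hd : Differentiable ℝ f := hf.differentiable (by norm_num)
  have hd2 : Differentiable ℝ (fderiv ℝ f) :=
    (hf.fderiv_right (m := 1) (by norm_num)).differentiable (by norm_num)
  have hlip : ∀ z, ‖fderiv ℝ f z - fderiv ℝ f x‖ ≤ C * ‖z - x‖ := fun z =>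
    Convex.norm_image_sub_le_of_norm_fderiv_le (fun w _ => hd2 w) (fun w _ => (hC w).2.2)
      convex_univ (Set.mem_univ x) (Set.mem_univ z)
  have hy : 0 ≤ ‖y‖ := norm_nonneg y
  have hfy : |fderiv ℝ f x y| ≤ C * ‖y‖ := by
    rw [← Real.norm_eq_abs]
    exact (ContinuousLinearMap.le_opNorm _ _).trans (by gcongr; exact (hC x).2.1)
  have hden : 0 < 1 + ‖y‖ ^ 2 := by positivity
  rcases min_one_sq_cases ‖y‖ hy with ⟨h1, h2⟩ | ⟨h1, h2⟩
  · have htaylor : |f (x + y) - f x - fderiv ℝ f x y| ≤ C * ‖y‖ * ‖y‖ := by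
      have := (convex_closedBall x ‖y‖).norm_image_sub_le_of_norm_fderiv_le' (f := f)
        (φ := fderiv ℝ f x) (C := C * ‖y‖) (x := x) (y := x + y) (fun w _ => hd w)
        (fun w hw => (hlip w).trans (by
          gcongr; rw [← dist_eq_norm]; exact Metric.mem_closedBall.1 hw))
        (Metric.mem_closedBall_self hy) (by simp)
      simpa using this
    have hcorr : |fderiv ℝ f x y - fderiv ℝ f x y / (1 + ‖y‖ ^ 2)| ≤ C * ‖y‖ ^ 2 := by
      have : fderiv ℝ f x y - fderiv ℝ f x y / (1 + ‖y‖ ^ 2) =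
          fderiv ℝ f x y * (‖y‖ ^ 2 / (1 + ‖y‖ ^ 2)) := by field_simp; ring
      rw [this, abs_mul, abs_of_nonneg (by positivity : 0 ≤ ‖y‖ ^ 2 / (1 + ‖y‖ ^ 2))]
      have h3 : ‖y‖ ^ 2 / (1 + ‖y‖ ^ 2) ≤ ‖y‖ ^ 2 := div_le_self (by positivity) (by nlinarith)
      have h4 : |fderiv ℝ f x y| ≤ C := hfy.trans (by nlinarith)
      gcongr
    rw [h2]
    have := abs_add_le (f (x + y) - f x - fderiv ℝ f x y)
      (fderiv ℝ f x y - fderiv ℝ f x y / (1 + ‖y‖ ^ 2))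
    rw [sub_add_sub_cancel] at this
    nlinarith [mul_nonneg hC0 (sq_nonneg ‖y‖)]
  · rw [h2]
    have h3 : |fderiv ℝ f x y / (1 + ‖y‖ ^ 2)| ≤ C := by
      rw [abs_div, abs_of_pos hden, div_le_iff₀ hden]
      refine hfy.trans ?_
      gcongr
      nlinarith
    have h4 := abs_sub (f (x + y) - f x) (fderiv ℝ f x y / (1 + ‖y‖ ^ 2))
    have h5 := abs_sub (f (x + y)) (f x)
    linarith [(hC x).1, (hC (x + y)).1]

/-- `A f` is bounded on `D` for each test function `f`. -/
theorem Coeffs.op_bounded {a : Coeffs d} {D : Set (Space d)} (h1 : a.Local D) (h2 : a.Levy)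
    {f : Space d → ℝ} (hf : IsCb2 f) : ∃ C : ℝ, ∀ x ∈ D, |a.op f x| ≤ C := by
  obtain ⟨hf2, C, hC⟩ := hf
  obtain ⟨CQ, hQ⟩ := h1.bounded_Q
  obtain ⟨Cb, hb⟩ := h1.bounded_b
  obtain ⟨CN, hN⟩ := h2.bounded
  have hC0 : 0 ≤ C := (norm_nonneg _).trans (hC 0).2.1
  refine ⟨(1 / 2) * (∑ _i : Fin d, ∑ _j : Fin d, CQ * C) + C * Cb + 3 * C * CN, fun x hx => ?_⟩
  have e1 : |(1 / 2) * (∑ i, ∑ j, a.Q x i j *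
      fderiv ℝ (fderiv ℝ f) x (EuclideanSpace.single i 1) (EuclideanSpace.single j 1))| ≤
      (1 / 2) * (∑ _i : Fin d, ∑ _j : Fin d, CQ * C) := by
    rw [abs_mul, abs_of_pos (by norm_num : (0 : ℝ) < 1 / 2)]
    gcongr
    refine (Finset.abs_sum_le_sum_abs _ _).trans (Finset.sum_le_sum fun i _ =>
      (Finset.abs_sum_le_sum_abs _ _).trans (Finset.sum_le_sum fun j _ => ?_))
    rw [abs_mul]
    have h3 : |fderiv ℝ (fderiv ℝ f) x (EuclideanSpace.single i 1) (EuclideanSpace.single j 1)|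
        ≤ C := by
      rw [← Real.norm_eq_abs]
      refine (ContinuousLinearMap.le_opNorm₂ _ _ _).trans ?_
      simpa using (hC x).2.2
    exact mul_le_mul (hQ x hx i j) h3 (abs_nonneg _) ((abs_nonneg _).trans (hQ x hx i j))
  have e2 : |fderiv ℝ f x (a.b x)| ≤ C * Cb := by
    rw [← Real.norm_eq_abs]
    exact (ContinuousLinearMap.le_opNorm _ _).trans
      (mul_le_mul (hC x).2.1 (hb x hx) (norm_nonneg _) hC0)
  have e3 : |∫ y, (f (x + y) - f x - fderiv ℝ f x y / (1 + ‖y‖ ^ 2)) ∂(a.N x)| ≤ 3 * C * CN := by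
    rw [← Real.norm_eq_abs]
    refine (norm_integral_le_lintegral_norm _).trans ?_
    refine ENNReal.toReal_le_of_le_ofReal (by positivity) ?_
    calc ∫⁻ y, ENNReal.ofReal ‖f (x + y) - f x - fderiv ℝ f x y / (1 + ‖y‖ ^ 2)‖ ∂(a.N x)
        ≤ ∫⁻ y, ENNReal.ofReal (3 * C) * ENNReal.ofReal (min 1 (‖y‖ ^ 2)) ∂(a.N x) := by
          refine lintegral_mono fun y => ?_
          rw [← ENNReal.ofReal_mul (by positivity)]
          exact ENNReal.ofReal_le_ofReal (abs_increment_le hf2 hC x y)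
      _ = ENNReal.ofReal (3 * C) * ∫⁻ y, ENNReal.ofReal (min 1 (‖y‖ ^ 2)) ∂(a.N x) :=
          lintegral_const_mul _ (by fun_prop)
      _ ≤ ENNReal.ofReal (3 * C) * CN := by gcongr; exact hN x
      _ = ENNReal.ofReal (3 * C * CN) := by
          rw [ENNReal.ofReal_mul (p := 3 * C) (by positivity), ENNReal.ofReal_coe_nnreal]
  unfold Coeffs.op
  exact (abs_add_le _ _).trans (add_le_add ((abs_add_le _ _).trans (add_le_add e1 e2)) e3)

/-! ### Dynkin's formula -/

variable {D : Set (Space d)}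

/-- The time integral of `A f` along the path up to the stopping time. -/
noncomputable def stoppedIntegral (a : Coeffs d) (D : Set (Space d)) (f : Space d → ℝ) (ε : ℝ)
    (t : ℝ≥0) (ω : Path d) : ℝ :=
  ∫ r in (0 : ℝ)..(stopAt D ε t ω), a.op f (X r.toNNReal ω)

theorem mem_of_lt_stopAt_real {ε : ℝ} (hε : 0 ≤ ε) {t : ℝ≥0} {ω : Path d} {r : ℝ}
    (h : r < stopAt D ε t ω) (hr : 0 ≤ r) : X r.toNNReal ω ∈ D :=
  mem_of_lt_stopAt hε (by rwa [Real.toNNReal_lt_iff_lt_coe hr])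

/-- **Dynkin's formula** up to the time `reach D ε ∧ t`. -/
theorem dynkin {a : Coeffs d} {μ : Measure (Space d)} {Pμ : Measure (Path d)}
    (hP : a.SolvesMP μ Pμ) {f : Space d → ℝ} (hf : IsCb2 f) (ε : ℝ) (t : ℝ≥0) :
    Integrable (stoppedIntegral a D f ε t) Pμ ∧
      ∫ ω, stoppedIntegral a D f ε t ω ∂Pμ =
        ∫ ω, f (X (stopAt D ε t ω) ω) ∂Pμ - ∫ x, f x ∂μ := by
  have := hP.prob
  have hM := hP.martingale f hf
  have hfc : Continuous f := hf.1.continuous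
  obtain ⟨C, hC⟩ := hf.2
  have hσ : ∀ s, MeasurableSet[natFiltration d s] {ω | stopAt D ε t ω ≤ s} := by
    intro s
    have : {ω : Path d | stopAt D ε t ω ≤ s} = {ω | runMin D s ω ≤ ε} ∪ {_ω | t ≤ s} := by
      ext ω; exact stopAt_le_iff
    rw [this]
    exact (measurable_runMin s measurableSet_Iic).union (MeasurableSet.const _)
  have hrc : ∀ᵐ ω ∂Pμ, ContinuousWithinAt (fun s => a.mgPath f s ω)
      (Set.Icc (stopAt D ε t ω) t) (stopAt D ε t ω) := by
    filter_upwards [hP.integrable f hf t] with ω hω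
    have c1 : ContinuousWithinAt (fun s => f (X s ω)) (Set.Icc (stopAt D ε t ω) t)
        (stopAt D ε t ω) :=
      hfc.continuousAt.comp_continuousWithinAt
        ((continuousWithinAt_X _ ω).mono Set.Icc_subset_Ici_self)
    have c2 : ContinuousOn (fun s : ℝ => ∫ r in (0 : ℝ)..s, a.op f (X r.toNNReal ω))
        (Set.uIcc 0 (t : ℝ)) :=
      intervalIntegral.continuousOn_primitive_interval' hω Set.left_mem_uIcc
    have c3 : ContinuousOn (fun s : ℝ≥0 => ∫ r in (0 : ℝ)..s, a.op f (X r.toNNReal ω))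
        (Set.Iic t) := by
      refine c2.comp NNReal.continuous_coe.continuousOn fun s hs => ?_
      rw [Set.uIcc_of_le t.coe_nonneg]
      exact ⟨s.coe_nonneg, NNReal.coe_le_coe.2 hs⟩
    exact (c1.sub continuousWithinAt_const).sub
      ((c3 _ (stopAt_le ε t ω)).mono Set.Icc_subset_Iic_self)
  obtain ⟨i1, i2⟩ := integral_stopped_eq hM hσ (stopAt_le ε t) hrc
  have i3 : ∫ ω, a.mgPath f t ω ∂Pμ = 0 := by
    have h0 := hM.setIntegral_eq (zero_le (a := t)) (s := Set.univ) MeasurableSet.univ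
    simp only [setIntegral_univ] at h0
    rw [← h0]
    simp [Coeffs.mgPath]
  have j1 : Integrable (fun ω => f (X (stopAt D ε t ω) ω)) Pμ :=
    .of_bound (hfc.measurable.comp (measurable_X_comp (measurable_stopAt ε t))).aestronglyMeasurable
      C (.of_forall fun ω => (hC _).1)
  have j2 : Integrable (fun ω => f (X 0 ω)) Pμ :=
    .of_bound (hfc.measurable.comp (measurable_X 0)).aestronglyMeasurable
      C (.of_forall fun ω => (hC _).1)
  have j3 : ∫ ω, f (X 0 ω) ∂Pμ = ∫ x, f x ∂μ := by
    rw [← hP.initial, integral_map (measurable_X 0).aemeasurable hfc.aestronglyMeasurable]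
  have e : stoppedIntegral a D f ε t = fun ω =>
      f (X (stopAt D ε t ω) ω) - f (X 0 ω) - a.mgPath f (stopAt D ε t ω) ω := by
    ext ω
    simp only [stoppedIntegral, Coeffs.mgPath]
    ring
  rw [e]
  refine ⟨(j1.sub j2).sub i1, ?_⟩
  have k1 := integral_sub (j1.sub j2) i1
  have k2 := integral_sub j1 j2
  simp only [Pi.sub_apply] at k1
  rw [k1, k2, i2, i3, j3, sub_zero]

/-- Between two of the stopping times the path is in `D`, where `A f` is bounded. -/
theorem abs_stoppedIntegral_sub_le {a : Coeffs d} {f : Space d → ℝ} {C : ℝ}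
    (hC : ∀ x ∈ D, |a.op f x| ≤ C) {ε ε' : ℝ} (hε : 0 ≤ ε) (hεε : ε ≤ ε') {t : ℝ≥0} {ω : Path d}
    (hω : IntervalIntegrable (fun r : ℝ => a.op f (X r.toNNReal ω)) volume 0 t) :
    |stoppedIntegral a D f ε t ω - stoppedIntegral a D f ε' t ω| ≤
      C * (stopAt D ε t ω - stopAt D ε' t ω) := by
  have hle : (stopAt D ε' t ω : ℝ) ≤ stopAt D ε t ω := NNReal.coe_le_coe.2 (stopAt_anti hεε t ω)
  have hsub : ∀ s : ℝ≥0, s ≤ t →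
      IntervalIntegrable (fun r : ℝ => a.op f (X r.toNNReal ω)) volume 0 s := fun s hs =>
    hω.mono_set (by
      rw [Set.uIcc_of_le s.coe_nonneg, Set.uIcc_of_le t.coe_nonneg]
      exact Set.Icc_subset_Icc le_rfl (NNReal.coe_le_coe.2 hs))
  unfold stoppedIntegral
  rw [intervalIntegral.integral_interval_sub_left (hsub _ (stopAt_le ε t ω))
    (hsub _ (stopAt_le ε' t ω)), ← Real.norm_eq_abs]
  refine (intervalIntegral.norm_integral_le_of_norm_le_const_ae (C := C) ?_).trans ?_
  · have h0 : ∀ᵐ r : ℝ, r ≠ (stopAt D ε t ω : ℝ) := by simp [ae_iff]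
    filter_upwards [h0] with r hr hmem
    rw [Set.uIoc_of_le hle] at hmem
    exact hC _ (mem_of_lt_stopAt_real hε (lt_of_le_of_ne hmem.2 hr)
      ((NNReal.coe_nonneg _).trans hmem.1.le))
  · rw [abs_of_nonneg (sub_nonneg.2 hle)]

end

section

variable {d : ℕ} {D : Set (Space d)}

/-! ### The path does not touch the complement of `D` without leaving `D` -/

theorem isCb2_of_hasCompactSupport {f : Space d → ℝ} (hf : ContDiff ℝ 2 f)
    (hs : HasCompactSupport f) : IsCb2 f := by
  obtain ⟨C0, h0⟩ := hf.continuous.bounded_above_of_compact_support hs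
  have hf1 : ContDiff ℝ 1 (fderiv ℝ f) := hf.fderiv_right (m := 1) (by norm_num)
  obtain ⟨C1, h1⟩ := hf1.continuous.bounded_above_of_compact_support (hs.fderiv (𝕜 := ℝ))
  obtain ⟨C2, h2⟩ := (hf1.continuous_fderiv (by norm_num)).bounded_above_of_compact_support
    ((hs.fderiv (𝕜 := ℝ)).fderiv (𝕜 := ℝ))
  refine ⟨hf, max C0 (max C1 C2), fun x => ⟨?_, ?_, ?_⟩⟩
  · exact (h0 x).trans (le_max_left _ _)
  · exact (h1 x).trans ((le_max_left _ _).trans (le_max_right _ _))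
  · exact (h2 x).trans ((le_max_right _ _).trans (le_max_right _ _))

theorem inv_nat_antitone {m n : ℕ} (h : m ≤ n) : 1 / ((n : ℝ) + 1) ≤ 1 / ((m : ℝ) + 1) := by
  gcongr

/-- The approximating times increase to the contact time. -/
theorem tendsto_stopAt (t : ℝ≥0) (ω : Path d) :
    Tendsto (fun n : ℕ => stopAt D (1 / ((n : ℝ) + 1)) t ω) atTop (𝓝 (stopAt D 0 t ω)) := by
  refine tendsto_order.2 ⟨fun s hs => ?_, fun s hs => .of_forall fun n =>
    (stopAt_anti (by positivity) t ω).trans_lt hs⟩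
  filter_upwards [(tendsto_one_div_add_atTop_nhds_zero_nat (𝕜 := ℝ)).eventually_lt_const
    (lt_runMin_of_lt_stopAt hs)] with n hn
  by_contra! h
  rcases stopAt_le_iff.1 h with h1 | h1
  · exact absurd h1 (not_le.2 hn)
  · exact absurd ((stopAt_le 0 t ω).trans h1) (not_le.2 hs)

/-- If the approximating times stay below the contact time, the left limit at the contact time lies
in the complement of `D`. -/
theorem gap_leftLim_eq_zero {t : ℝ≥0} {ω : Path d} (ht : runMin D t ω ≤ 0)
    (hlt : ∀ n : ℕ, stopAt D (1 / ((n : ℝ) + 1)) t ω < stopAt D 0 t ω) {l : Space d}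
    (hl : Tendsto (fun s => X s ω) (𝓝[<] (stopAt D 0 t ω)) (𝓝 l)) : gap D l = 0 := by
  by_contra hne
  have hpos : 0 < gap D l := lt_of_le_of_ne (gap_nonneg l) (Ne.symm hne)
  have hev : ∀ᶠ s in 𝓝[<] (stopAt D 0 t ω), gap D l / 2 < gap D (X s ω) :=
    (continuous_gap.continuousAt.tendsto.comp hl).eventually_const_lt (by linarith)
  obtain ⟨s0, hs0, hsub⟩ := (mem_nhdsLT_iff_exists_Ioo_subset' (hlt 0)).1 hev
  have hr0 : 0 < runMin D s0 ω := lt_runMin_of_lt_stopAt hs0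
  obtain ⟨n, hn⟩ := ((tendsto_one_div_add_atTop_nhds_zero_nat (𝕜 := ℝ)).eventually_lt_const
    (lt_min (half_pos hpos) hr0)).exists
  have h1 : runMin D (stopAt D (1 / ((n : ℝ) + 1)) t ω) ω ≤ 1 / ((n : ℝ) + 1) :=
    runMin_stopAt_le (ht.trans (by positivity))
  refine absurd (h1.trans_lt hn) (not_lt.2 (le_runMin fun s hs => ?_))
  rcases le_or_gt s s0 with h | h
  · exact (min_le_right _ _).trans (runMin_le h ω)
  · exact (min_le_left _ _).trans (hsub ⟨h, hs.trans_lt (hlt n)⟩ : gap D l / 2 < _).le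

/-- Let `f` vanish near the complement of `D`. As `ε ↓ 0`, the increment of `f` between the times
`reach D ε` and `reach D 0` (capped at `t`) becomes the value of `f` at the contact time. -/
theorem tendsto_increment {f : Space d → ℝ} (hf : Continuous f)
    (h0 : ∀ z, gap D z = 0 → f z = 0) (t : ℝ≥0) (ω : Path d) :
    Tendsto (fun n : ℕ => f (X (stopAt D 0 t ω) ω) - f (X (stopAt D (1 / ((n : ℝ) + 1)) t ω) ω))
      atTop (𝓝 ({ω | runMin D t ω ≤ 0}.indicator (fun ω => f (X (stopAt D 0 t ω) ω)) ω)) := by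
  by_cases ht : runMin D t ω ≤ 0
  · rw [Set.indicator_of_mem (by exact ht)]
    -- Either the path jumps into `Dᶜ` from a positive distance, or it has a left limit in `Dᶜ`.
    by_cases h : ∃ n : ℕ, stopAt D 0 t ω ≤ stopAt D (1 / ((n : ℝ) + 1)) t ω
    · obtain ⟨n, hn⟩ := h
      have hgap : gap D (X (stopAt D 0 t ω) ω) = 0 := by
        by_contra hne
        have hpos := lt_of_le_of_ne (gap_nonneg (D := D) (X (stopAt D 0 t ω) ω)) (Ne.symm hne)
        refine absurd (runMin_stopAt_le ht) (not_le.2 (lt_of_lt_of_le (lt_min hpos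
          (by positivity : 0 < 1 / ((n : ℝ) + 1))) (le_runMin fun s hs => ?_)))
        rcases hs.eq_or_lt with rfl | h
        · exact min_le_left _ _
        · exact (min_le_right _ _).trans
            ((lt_runMin_of_lt_stopAt (h.trans_le hn)).le.trans (runMin_le le_rfl ω))
      rw [h0 _ hgap]
      refine tendsto_const_nhds.congr' ?_
      filter_upwards [eventually_ge_atTop n] with m hm
      have : stopAt D (1 / ((m : ℝ) + 1)) t ω = stopAt D 0 t ω :=
        le_antisymm (stopAt_anti (by positivity) t ω)
          (hn.trans (stopAt_anti (inv_nat_antitone hm) t ω))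
      rw [this, h0 _ hgap, sub_zero]
    · push Not at h
      obtain ⟨l, hl⟩ := (ω.2 (stopAt D 0 t ω)).2
      have hfl : f l = 0 := h0 l (gap_leftLim_eq_zero ht h hl)
      have h1 : Tendsto (fun n : ℕ => f (X (stopAt D (1 / ((n : ℝ) + 1)) t ω) ω)) atTop
          (𝓝 (f l)) :=
        (hf.tendsto l).comp (hl.comp (tendsto_nhdsWithin_iff.2
          ⟨tendsto_stopAt t ω, .of_forall fun n => h n⟩))
      simpa [hfl] using (tendsto_const_nhds (x := f (X (stopAt D 0 t ω) ω))).sub h1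
  · rw [Set.indicator_of_notMem (by exact ht)]
    push Not at ht
    refine tendsto_const_nhds.congr' ?_
    filter_upwards [(tendsto_one_div_add_atTop_nhds_zero_nat (𝕜 := ℝ)).eventually_lt_const ht]
      with n hn
    rw [stopAt_eq_right hn, stopAt_eq_right ht, sub_self]

theorem measurableSet_runMin_le (t : ℝ≥0) (ε : ℝ) :
    MeasurableSet {ω : Path d | runMin D t ω ≤ ε} :=
  ((measurable_runMin t).mono ((natFiltration d).le t) le_rfl) measurableSet_Iic

variable {a : Coeffs d} {μ : Measure (Space d)} {Pμ : Measure (Path d)}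

/-- A non-negative test function vanishing near the complement of `D` vanishes at the contact
time: by Dynkin's formula its mean increment between `reach D ε` and `reach D 0` tends to `0`. -/
theorem ae_testFunction_eq_zero (h1 : a.Local D) (h2 : a.Levy) (hP : a.SolvesMP μ Pμ)
    {f : Space d → ℝ} (hf : IsCb2 f) (hf0 : ∀ z, 0 ≤ f z) (h0 : ∀ z, gap D z = 0 → f z = 0)
    (t : ℝ≥0) : ∀ᵐ ω ∂Pμ, runMin D t ω ≤ 0 → f (X (stopAt D 0 t ω) ω) = 0 := by
  have := hP.prob
  have hfc : Continuous f := hf.1.continuous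
  obtain ⟨K, hK⟩ := Coeffs.op_bounded h1 h2 hf
  obtain ⟨C, hC⟩ := hf.2
  have hm : ∀ ε, Measurable fun ω => f (X (stopAt D ε t ω) ω) := fun ε =>
    hfc.measurable.comp (measurable_X_comp (measurable_stopAt ε t))
  have hi : ∀ ε, Integrable (fun ω => f (X (stopAt D ε t ω) ω)) Pμ := fun ε =>
    .of_bound (hm ε).aestronglyMeasurable C (.of_forall fun ω => (hC _).1)
  have l1 : Tendsto (fun n : ℕ => ∫ ω, (f (X (stopAt D 0 t ω) ω) -
      f (X (stopAt D (1 / ((n : ℝ) + 1)) t ω) ω)) ∂Pμ) atTop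
      (𝓝 (∫ ω, {ω | runMin D t ω ≤ 0}.indicator (fun ω => f (X (stopAt D 0 t ω) ω)) ω ∂Pμ)) := by
    refine tendsto_integral_of_dominated_convergence (fun _ => C + C)
      (fun n => ((hm _).sub (hm _)).aestronglyMeasurable) (integrable_const _)
      (fun n => .of_forall fun ω => ?_) (.of_forall fun ω => tendsto_increment hfc h0 t ω)
    exact (norm_sub_le _ _).trans (add_le_add (hC _).1 (hC _).1)
  have l2 : Tendsto (fun n : ℕ => ∫ ω, (stoppedIntegral a D f 0 t ω -
      stoppedIntegral a D f (1 / ((n : ℝ) + 1)) t ω) ∂Pμ) atTop (𝓝 (∫ _ω, (0 : ℝ) ∂Pμ)) := by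
    refine tendsto_integral_of_dominated_convergence (fun _ => |K| * t)
      (fun n => ((dynkin hP hf _ t).1.sub (dynkin hP hf _ t).1).aestronglyMeasurable)
      (integrable_const _) (fun n => ?_) ?_
    · filter_upwards [hP.integrable f hf t] with ω hω
      refine (abs_stoppedIntegral_sub_le hK le_rfl (by positivity) hω).trans ?_
      have e1 := stopAt_anti (D := D) (by positivity : (0 : ℝ) ≤ 1 / ((n : ℝ) + 1)) t ω
      have e2 := stopAt_le (D := D) 0 t ω
      have e1' : (stopAt D (1 / ((n : ℝ) + 1)) t ω : ℝ) ≤ stopAt D 0 t ω := e1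
      have e2' : (stopAt D 0 t ω : ℝ) ≤ t := e2
      exact mul_le_mul (le_abs_self K)
        ((sub_le_self _ (NNReal.coe_nonneg _)).trans e2') (sub_nonneg.2 e1') (abs_nonneg _)
    · filter_upwards [hP.integrable f hf t] with ω hω
      have h3 : Tendsto (fun n : ℕ => K * ((stopAt D 0 t ω : ℝ) -
          stopAt D (1 / ((n : ℝ) + 1)) t ω)) atTop (𝓝 0) := by
        have := ((NNReal.continuous_coe.tendsto _).comp
          (tendsto_stopAt (D := D) t ω)).const_sub (stopAt D 0 t ω : ℝ)
        simpa using this.const_mul K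
      exact squeeze_zero_norm (fun n =>
        abs_stoppedIntegral_sub_le hK le_rfl (by positivity) hω) h3
  have l3 : ∀ n : ℕ, ∫ ω, (f (X (stopAt D 0 t ω) ω) -
      f (X (stopAt D (1 / ((n : ℝ) + 1)) t ω) ω)) ∂Pμ = ∫ ω, (stoppedIntegral a D f 0 t ω -
      stoppedIntegral a D f (1 / ((n : ℝ) + 1)) t ω) ∂Pμ := fun n => by
    rw [integral_sub (hi _) (hi _), integral_sub (dynkin hP hf _ t).1 (dynkin hP hf _ t).1,
      (dynkin hP hf _ t).2, (dynkin hP hf _ t).2]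
    ring
  simp only [l3] at l1
  have l4 := tendsto_nhds_unique l1 l2
  rw [integral_zero, integral_eq_zero_iff_of_nonneg
    (fun ω => Set.indicator_nonneg (fun ω _ => hf0 _) ω)
    ((hi 0).indicator (measurableSet_runMin_le t 0))] at l4
  filter_upwards [l4] with ω hω hr
  rwa [Set.indicator_of_mem (by exact hr)] at hω

/-- Quasi-left-continuity at the boundary: at the contact time the path is outside `D`. -/
theorem ae_notMem_of_contact (hD : IsOpen D) (hD' : Dᶜ.Nonempty) (h1 : a.Local D) (h2 : a.Levy)
    (hP : a.SolvesMP μ Pμ) (t : ℝ≥0) :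
    ∀ᵐ ω ∂Pμ, runMin D t ω ≤ 0 → X (stopAt D 0 t ω) ω ∉ D := by
  have hmX := measurable_X_comp (measurable_stopAt (d := d) (D := D) 0 t)
  set κ := (Pμ.restrict {ω | runMin D t ω ≤ 0}).map fun ω => X (stopAt D 0 t ω) ω with hκ
  have key : κ D = 0 := by
    refine measure_null_of_locally_null D fun z hz => ?_
    have hg := gap_pos hD hD' hz
    obtain ⟨f, f1, f2, f3, f4, f5⟩ := exists_contDiff_tsupport_subset (n := 2)
      (Metric.closedBall_mem_nhds z (half_pos hg))
    have hfnn : ∀ w, 0 ≤ f w := fun w => (f4 ⟨w, rfl⟩).1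
    have hf0 : ∀ w, gap D w = 0 → f w = 0 := by
      intro w hw
      by_contra hne
      have hb : dist w z ≤ gap D z / 2 := f1 (subset_tsupport f hne)
      have := Metric.infDist_le_infDist_add_dist (s := Dᶜ) (x := z) (y := w)
      rw [dist_comm] at hb
      unfold gap at *
      linarith
    have hf2 : IsCb2 f := isCb2_of_hasCompactSupport (by exact_mod_cast f3) f2
    have hU : IsOpen {w | 0 < f w} := isOpen_lt continuous_const hf2.1.continuous
    refine ⟨{w | 0 < f w}, mem_nhdsWithin_of_mem_nhds
      (hU.mem_nhds (by simp [f5])), ?_⟩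
    rw [hκ, Measure.map_apply hmX hU.measurableSet, measure_eq_zero_iff_ae_notMem,
      ae_restrict_iff' (measurableSet_runMin_le t 0)]
    filter_upwards [ae_testFunction_eq_zero h1 h2 hP hf2 hfnn hf0 t] with ω hω hr hlt
    exact absurd (hω hr) (ne_of_gt hlt)
  rw [hκ, Measure.map_apply hmX hD.measurableSet, measure_eq_zero_iff_ae_notMem,
    ae_restrict_iff' (measurableSet_runMin_le t 0)] at key
  exact key

theorem reach_le_exitTime (ω : Path d) : reach D 0 ω ≤ exitTime D ω := by
  refine le_iInf₂ fun s hs => reach_le_iff.2 ?_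
  rw [← gap_of_notMem hs.2]
  exact runMin_le le_rfl ω

theorem ae_initial {x : Space d} (hP : a.SolvesMP (Measure.dirac x) Pμ) :
    ∀ᵐ ω ∂Pμ, X 0 ω = x := by
  have h : ∀ᵐ y ∂(Pμ.map (X 0)), y = x := by
    rw [hP.initial]
    exact (ae_dirac_iff (p := fun y => y = x) (measurableSet_singleton x)).2 rfl
  exact ae_of_ae_map (measurable_X 0).aemeasurable h

/-- The exit time agrees almost surely with a stopping time of the natural filtration. -/
theorem ae_exitTime_eq (hD : IsOpen D) (hD' : Dᶜ.Nonempty) (h1 : a.Local D) (h2 : a.Levy)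
    {x : Space d} (hx : x ∈ D) (hP : a.SolvesMP (Measure.dirac x) Pμ) :
    ∀ᵐ ω ∂Pμ, exitTime D ω = reach D 0 ω := by
  have h3 : ∀ᵐ ω ∂Pμ, ∀ n : ℕ, runMin D (n : ℝ≥0) ω ≤ 0 → X (stopAt D 0 n ω) ω ∉ D :=
    ae_all_iff.2 fun n => ae_notMem_of_contact hD hD' h1 h2 hP n
  filter_upwards [h3, ae_initial hP] with ω hω h0
  refine le_antisymm ?_ (reach_le_exitTime ω)
  by_cases hr : reach D 0 ω = ⊤
  · rw [hr]; exact le_top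
  obtain ⟨n, hn⟩ := exists_nat_gt (reach D 0 ω).toNNReal
  have hn' : reach D 0 ω ≤ (n : ℝ≥0) := by
    rw [← ENNReal.coe_toNNReal hr]; exact ENNReal.coe_le_coe.2 hn.le
  have hs : (stopAt D 0 n ω : ℝ≥0∞) = reach D 0 ω := by rw [coe_stopAt, min_eq_left hn']
  have hpos : 0 < stopAt D 0 n ω := by
    have h4 : ((0 : ℝ≥0) : ℝ≥0∞) < reach D 0 ω := by
      rw [lt_reach_iff]
      refine (gap_pos hD hD' hx).trans_le (le_runMin fun s hs => ?_)
      rw [nonpos_iff_eq_zero.1 hs, h0]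
    rw [← hs] at h4
    exact ENNReal.coe_lt_coe.1 h4
  rw [← hs]
  exact iInf₂_le (stopAt D 0 n ω) ⟨hpos, hω n (reach_le_iff.1 hn')⟩

end

section

variable {d : ℕ} {D : Set (Space d)} {a : Coeffs d} {Pμ : Measure (Path d)}

/-! ### The landing position at the exit time -/

/-- A smooth bump function for a compact set, supported in a thickening of it. -/
theorem exists_bump {K : Set (Space d)} (hK : IsCompact K) {δ : ℝ} (hδ : 0 < δ) :
    ∃ f : Space d → ℝ, IsCb2 f ∧ (∀ z, 0 ≤ f z) ∧ (∀ z, f z ≤ 1) ∧ (∀ z ∈ K, f z = 1) ∧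
      ∀ z, f z ≠ 0 → z ∈ Metric.thickening δ K := by
  obtain ⟨f, f1, f2, f3⟩ := exists_contMDiffMap_zero_one_of_isClosed (n := 2)
    (modelWithCornersSelf ℝ (Space d)) (s := (Metric.thickening δ K)ᶜ) (t := K)
    Metric.isOpen_thickening.isClosed_compl hK.isClosed
    (Set.disjoint_compl_left_iff_subset.2 (Metric.self_subset_thickening hδ K))
  have hsupp : ∀ z, f z ≠ 0 → z ∈ Metric.thickening δ K := fun z hz => by
    by_contra h
    exact hz (f1 h)
  have hs : HasCompactSupport f := HasCompactSupport.of_support_subset_isCompact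
    (hK.cthickening (r := δ)) fun z hz => Metric.thickening_subset_cthickening δ K (hsupp z hz)
  have hc : ContDiff ℝ 2 f := by exact_mod_cast f.contMDiff.contDiff
  exact ⟨f, isCb2_of_hasCompactSupport hc hs, fun z => (f3 z).1, fun z => (f3 z).2,
    fun z hz => f2 hz, hsupp⟩

/-- On an open set where the test function vanishes, only the jump part of the operator remains. -/
theorem Coeffs.op_eq_integral (hD : IsOpen D) {f : Space d → ℝ} (hf : ∀ z ∈ D, f z = 0)
    {z : Space d} (hz : z ∈ D) : a.op f z = ∫ y, f (z + y) ∂(a.N z) := by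
  have h0 : ∀ w ∈ D, fderiv ℝ f w = 0 := fun w hw => by
    have : f =ᶠ[𝓝 w] fun _ => 0 := Filter.eventually_of_mem (hD.mem_nhds hw) hf
    rw [this.fderiv_eq]
    exact fderiv_const_apply 0
  have h1 : fderiv ℝ (fderiv ℝ f) z = 0 := by
    have : fderiv ℝ f =ᶠ[𝓝 z] fun _ => 0 := Filter.eventually_of_mem (hD.mem_nhds hz) h0
    rw [this.fderiv_eq]
    exact fderiv_const_apply 0
  simp [Coeffs.op, h0 z hz, h1, hf z hz]

/-- A Lévy kernel gives uniformly bounded mass to the complement of a ball. -/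
theorem Coeffs.Levy.exists_tail_le (h : a.Levy) {δ : ℝ} (hδ : 0 < δ) :
    ∃ C : ℝ≥0, ∀ z, a.N z {y | δ ≤ ‖y‖} ≤ C := by
  obtain ⟨C, hC⟩ := h.bounded
  have hpos : 0 < min 1 (δ ^ 2) := lt_min one_pos (by positivity)
  have h0 : ENNReal.ofReal (min 1 (δ ^ 2)) ≠ 0 := (ENNReal.ofReal_pos.2 hpos).ne'
  refine ⟨(C / ENNReal.ofReal (min 1 (δ ^ 2))).toNNReal, fun z => ?_⟩
  rw [ENNReal.coe_toNNReal (ENNReal.div_ne_top ENNReal.coe_ne_top h0),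
    ENNReal.le_div_iff_mul_le (Or.inl h0) (Or.inl ENNReal.ofReal_ne_top), mul_comm]
  have hsub : {y : Space d | δ ≤ ‖y‖} ⊆
      {y | ENNReal.ofReal (min 1 (δ ^ 2)) ≤ ENNReal.ofReal (min 1 (‖y‖ ^ 2))} := fun y hy =>
    ENNReal.ofReal_le_ofReal (min_le_min le_rfl (pow_le_pow_left₀ hδ.le hy 2))
  exact (mul_le_mul_right (measure_mono hsub) _).trans
    ((mul_meas_ge_le_lintegral (by fun_prop) _).trans (hC z))

/-- The path cannot jump out of `D` into a compact set that is not charged by the jump kernels of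
the points of `D`: apply Dynkin's formula to bump functions decreasing to its indicator. -/
theorem measure_landing_isCompact (hD : IsOpen D) (h2 : a.Levy) {x : Space d} (hx : x ∈ D)
    (hP : a.SolvesMP (Measure.dirac x) Pμ) {K : Set (Space d)} (hK : IsCompact K)
    (hKD : Disjoint K (closure D)) (hN : ∀ z ∈ D, a.N z {y | z + y ∈ K} = 0) (t : ℝ≥0) :
    Pμ {ω | X (stopAt D 0 t ω) ω ∈ K} = 0 := by
  have := hP.prob
  obtain ⟨δ, hδ, hdis⟩ := hKD.exists_thickenings hK isClosed_closure
  have hδn : ∀ n : ℕ, 0 < δ / 2 * (1 / ((n : ℝ) + 1)) := fun n => by positivity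
  have hδn' : ∀ n : ℕ, δ / 2 * (1 / ((n : ℝ) + 1)) ≤ δ / 2 := fun n =>
    mul_le_of_le_one_right (by positivity) (by rw [div_le_one (by positivity)]; simp)
  choose f f1 f2 f3 f4 f5 using fun n : ℕ => exists_bump hK (hδn n)
  have hthick : ∀ n z, f n z ≠ 0 → z ∈ Metric.thickening (δ / 2) K := fun n z hz =>
    Metric.thickening_mono (hδn' n) K (f5 n z hz)
  have hDK : ∀ z ∈ D, z ∉ Metric.thickening δ K := fun z hz h =>
    Set.disjoint_left.1 hdis h (Metric.self_subset_thickening hδ _ (subset_closure hz))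
  have hfD : ∀ n, ∀ z ∈ D, f n z = 0 := fun n z hz => by
    by_contra h
    exact hDK z hz (Metric.thickening_mono (by linarith) K (hthick n z h))
  have hfar : ∀ n, ∀ z ∈ D, ∀ y, f n (z + y) ≠ 0 → δ / 2 ≤ ‖y‖ := by
    intro n z hz y hy
    obtain ⟨w, hw, hd⟩ := Metric.mem_thickening_iff.1 (hthick n _ hy)
    by_contra! hlt
    refine hDK z hz (Metric.mem_thickening_iff.2 ⟨w, hw, ?_⟩)
    have h3 := dist_triangle z (z + y) w
    rw [dist_self_add_right] at h3
    linarith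
  obtain ⟨C, hC⟩ := h2.exists_tail_le (half_pos hδ)
  have hbound : ∀ n, ∀ z ∈ D, ∀ y, ‖f n (z + y)‖ ≤ {y | δ / 2 ≤ ‖y‖}.indicator (fun _ => 1) y := by
    intro n z hz y
    rw [Real.norm_of_nonneg (f2 n _)]
    by_cases hy : f n (z + y) = 0
    · rw [hy]; exact Set.indicator_nonneg (fun _ _ => zero_le_one) _
    · rw [Set.indicator_of_mem (by exact hfar n z hz y hy)]; exact f3 n _
  have hmeas : MeasurableSet {y : Space d | δ / 2 ≤ ‖y‖} :=
    measurableSet_le measurable_const measurable_norm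
  have hindI : ∀ z, Integrable ({y | δ / 2 ≤ ‖y‖}.indicator fun _ => (1 : ℝ)) (a.N z) := fun z =>
    (integrable_indicator_iff hmeas).2
      (integrableOn_const ((hC z).trans_lt ENNReal.coe_lt_top).ne)
  have hop : ∀ n, ∀ z ∈ D, |a.op (f n) z| ≤ C := by
    intro n z hz
    rw [Coeffs.op_eq_integral hD (hfD n) hz, ← Real.norm_eq_abs]
    refine (norm_integral_le_of_norm_le (hindI z) (.of_forall (hbound n z hz))).trans ?_
    rw [integral_indicator_const _ hmeas, smul_eq_mul, mul_one]
    exact ENNReal.toReal_le_coe_of_le_coe (hC z)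
  have hoplim : ∀ z ∈ D, Tendsto (fun n => a.op (f n) z) atTop (𝓝 0) := by
    intro z hz
    have h0 : ∀ᵐ y ∂(a.N z), z + y ∉ K := measure_eq_zero_iff_ae_notMem.1 (hN z hz)
    have := tendsto_integral_of_dominated_convergence (μ := a.N z) (F := fun n y => f n (z + y))
      (f := fun _ => 0) _ (fun n => ((f1 n).1.continuous.comp (by fun_prop)).aestronglyMeasurable)
      (hindI z) (fun n => .of_forall (hbound n z hz)) (by
        filter_upwards [h0] with y hy
        have hpos : 0 < Metric.infEDist (z + y) K := by
          rw [Metric.infEDist_pos_iff_notMem_closure, hK.isClosed.closure_eq]; exact hy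
        have hlim : Tendsto (fun n : ℕ => ENNReal.ofReal (δ / 2 * (1 / ((n : ℝ) + 1)))) atTop
            (𝓝 0) := by
          have := ((tendsto_one_div_add_atTop_nhds_zero_nat (𝕜 := ℝ)).const_mul (δ / 2))
          simpa using ENNReal.tendsto_ofReal this
        refine tendsto_const_nhds.congr' ?_
        filter_upwards [hlim.eventually_lt_const hpos] with n hn
        by_contra h
        exact lt_asymm hn (f5 n _ (Ne.symm h)))
    simp only [integral_zero] at this
    refine this.congr fun n => (Coeffs.op_eq_integral hD (hfD n) hz).symm
  have hint : ∀ᵐ ω ∂Pμ, ∀ n, IntervalIntegrable (fun r : ℝ => a.op (f n) (X r.toNNReal ω))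
      volume 0 t := ae_all_iff.2 fun n => hP.integrable (f n) (f1 n) t
  have hne : ∀ s : ℝ, ∀ᵐ r : ℝ, r ≠ s := fun s => by simp [ae_iff]
  have hrb : ∀ n ω, ∀ᵐ r : ℝ, r ∈ Set.uIoc (0 : ℝ) (stopAt D 0 t ω) →
      ‖a.op (f n) (X r.toNNReal ω)‖ ≤ C := fun n ω => by
    filter_upwards [hne (stopAt D 0 t ω)] with r hr hmem
    rw [Set.uIoc_of_le (NNReal.coe_nonneg _)] at hmem
    exact hop n _ (mem_of_lt_stopAt_real le_rfl (lt_of_le_of_ne hmem.2 hr) hmem.1.le)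
  have hlimI : Tendsto (fun n => ∫ ω, stoppedIntegral a D (f n) 0 t ω ∂Pμ) atTop
      (𝓝 (∫ _ω, (0 : ℝ) ∂Pμ)) := by
    refine tendsto_integral_of_dominated_convergence (fun _ => (C : ℝ) * t)
      (fun n => (dynkin hP (f1 n) 0 t).1.aestronglyMeasurable) (integrable_const _)
      (fun n => .of_forall fun ω => ?_) ?_
    · refine (intervalIntegral.norm_integral_le_of_norm_le_const_ae (hrb n ω)).trans ?_
      rw [sub_zero, abs_of_nonneg (NNReal.coe_nonneg _)]
      have : (stopAt D 0 t ω : ℝ) ≤ t := stopAt_le 0 t ω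
      gcongr
    · filter_upwards [hint] with ω hω
      have := intervalIntegral.tendsto_integral_filter_of_dominated_convergence (μ := volume)
        (a := 0) (b := stopAt D 0 t ω) (l := atTop)
        (F := fun n (r : ℝ) => a.op (f n) (X r.toNNReal ω)) (f := fun _ => 0) (fun _ => (C : ℝ))
        (.of_forall fun n => (by
          rw [Set.uIoc_of_le (NNReal.coe_nonneg _)]
          exact (hω n).1.aestronglyMeasurable.mono_set
            (Set.Ioc_subset_Ioc le_rfl (NNReal.coe_le_coe.2 (stopAt_le 0 t ω)))))
        (.of_forall fun n => hrb n ω) intervalIntegrable_const (by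
          filter_upwards [hne (stopAt D 0 t ω)] with r hr hmem
          rw [Set.uIoc_of_le (NNReal.coe_nonneg _)] at hmem
          exact hoplim _ (mem_of_lt_stopAt_real le_rfl (lt_of_le_of_ne hmem.2 hr) hmem.1.le))
      simpa [stoppedIntegral] using this
  rw [integral_zero] at hlimI
  have hmX := measurable_X_comp (measurable_stopAt (d := d) (D := D) 0 t)
  have hle : ∀ n, Pμ.real {ω | X (stopAt D 0 t ω) ω ∈ K} ≤
      ∫ ω, stoppedIntegral a D (f n) 0 t ω ∂Pμ := by
    intro n
    rw [(dynkin hP (f1 n) 0 t).2, integral_dirac, hfD n x hx, sub_zero,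
      ← integral_indicator_one (show MeasurableSet {ω | X (stopAt D 0 t ω) ω ∈ K} from
        hmX hK.measurableSet)]
    refine integral_mono_of_nonneg (.of_forall fun ω =>
      Set.indicator_nonneg (fun _ _ => zero_le_one) _) (.of_bound
        ((f1 n).1.continuous.measurable.comp hmX).aestronglyMeasurable 1
        (.of_forall fun ω => ?_)) (.of_forall fun ω => ?_)
    · rw [Real.norm_of_nonneg (f2 n _)]; exact f3 n _
    · change Set.indicator _ 1 ω ≤ f n (X (stopAt D 0 t ω) ω)
      by_cases hω : X (stopAt D 0 t ω) ω ∈ K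
      · rw [f4 n _ hω, Set.indicator_of_mem (by exact hω), Pi.one_apply]
      · rw [Set.indicator_of_notMem (by exact hω)]; exact f2 n _
  have := ge_of_tendsto' hlimI hle
  exact (measureReal_eq_zero_iff).1 (le_antisymm this measureReal_nonneg)

/-- At the exit time, capped at `t`, the path is almost surely at a point where `u` does not exceed
its supremum over the extended domain. -/
theorem ae_le_supOn (hD : IsOpen D) (h2 : a.Levy) {x : Space d} (hx : x ∈ D)
    (hP : a.SolvesMP (Measure.dirac x) Pμ) {u : Space d → ℝ} (hu : Measurable u)
    {C : ℝ} (hC : ∀ x, |u x| ≤ C) (t : ℝ≥0) :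
    ∀ᵐ ω ∂Pμ, u (X (stopAt D 0 t ω) ω) ≤ supOn (a.extDomain D) u := by
  have := hP.prob
  have hmX := measurable_X_comp (measurable_stopAt (d := d) (D := D) 0 t)
  set M := supOn (a.extDomain D) u with hM
  have hle : ∀ z ∈ a.extDomain D, u z ≤ M := fun z hz =>
    le_csSup ⟨C, by rintro _ ⟨w, _, rfl⟩; exact (le_abs_self _).trans (hC w)⟩ ⟨z, hz, rfl⟩
  have hcl : closure D ⊆ a.extDomain D := by
    intro z hz
    by_cases h : z ∈ D
    · exact Or.inr h
    · exact Or.inl (Or.inl ⟨hz, fun h' => h (interior_subset h')⟩)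
  have hB : MeasurableSet {z | M < u z} := measurableSet_lt measurable_const hu
  have hdisj : ∀ z, M < u z → z ∉ a.extDomain D := fun z hz h => absurd (hle z h) (not_le.2 hz)
  have key : Pμ.map (fun ω => X (stopAt D 0 t ω) ω) {z | M < u z} = 0 := by
    by_contra hne
    obtain ⟨K, hKB, hK, hpos⟩ := hB.exists_lt_isCompact (pos_iff_ne_zero.2 hne)
    refine hpos.ne' ?_
    rw [Measure.map_apply hmX hK.measurableSet]
    refine measure_landing_isCompact hD h2 hx hP hK (Set.disjoint_left.2 fun z hz hz' =>
      hdisj z (hKB hz) (hcl hz')) (fun z hz => ?_) t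
    refine measure_mono_null (fun y hy => ?_) (Measure.measure_compl_support (μ := a.N z))
    intro hsupp
    refine hdisj _ (hKB hy) ?_
    have hr : z + y ∈ a.nonlocalRange D := Set.mem_biUnion hz ⟨y, hsupp, rfl⟩
    by_cases h : z + y ∈ D
    · exact Or.inr h
    · exact Or.inl (Or.inr ⟨hr, h⟩)
  rw [Measure.map_apply hmX hB] at key
  filter_upwards [measure_eq_zero_iff_ae_notMem.1 key] with ω hω
  exact not_lt.1 hω

end

section

variable {d : ℕ} {D : Set (Space d)} {a : Coeffs d} {P : Kernel (Space d) (Path d)}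

/-! ### The killed semigroup -/

/-- The semigroup of the process killed at the time `reach D 0`, acting on `[0, ∞]`-valued
functions. -/
noncomputable def killed (P : Kernel (Space d) (Path d)) (D : Set (Space d)) (t : ℝ≥0)
    (h : Space d → ℝ≥0∞) (x : Space d) : ℝ≥0∞ :=
  ∫⁻ ω in {ω | 0 < runMin D t ω}, h (X t ω) ∂(P x)

theorem measurableSet_alive (t : ℝ≥0) :
    MeasurableSet[natFiltration d t] {ω : Path d | 0 < runMin D t ω} :=
  measurable_runMin t measurableSet_Ioi

theorem measurableSet_alive' (t : ℝ≥0) : MeasurableSet {ω : Path d | 0 < runMin D t ω} :=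
  (natFiltration d).le t _ (measurableSet_alive t)

theorem mem_of_alive {t : ℝ≥0} {ω : Path d} (h : 0 < runMin D t ω) : X t ω ∈ D :=
  mem_of_gap_pos (h.trans_le (runMin_le le_rfl ω))

theorem measurable_killed {h : Space d → ℝ≥0∞} (hh : Measurable h) (t : ℝ≥0) :
    Measurable (killed P D t h) := by
  unfold killed
  simp only [← lintegral_indicator (measurableSet_alive' t)]
  exact ((hh.comp (measurable_X t)).indicator (measurableSet_alive' t)).lintegral_kernel

theorem killed_mono {h h' : Space d → ℝ≥0∞} (hle : ∀ z ∈ D, h z ≤ h' z) (t : ℝ≥0) (x : Space d) :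
    killed P D t h x ≤ killed P D t h' x :=
  setLIntegral_mono' (measurableSet_alive' t) fun _ hω => hle _ (mem_of_alive hω)

theorem killed_add_fun {h : Space d → ℝ≥0∞} (hh : Measurable h) (h' : Space d → ℝ≥0∞) (t : ℝ≥0)
    (x : Space d) : killed P D t (fun z => h z + h' z) x = killed P D t h x + killed P D t h' x :=
  lintegral_add_left (hh.comp (measurable_X t)) _

theorem killed_const_mul {h : Space d → ℝ≥0∞} (hh : Measurable h) (k : ℝ≥0∞) (t : ℝ≥0)
    (x : Space d) : killed P D t (fun z => k * h z) x = k * killed P D t h x :=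
  lintegral_const_mul _ (hh.comp (measurable_X t))

theorem killed_sum {h : ℕ → Space d → ℝ≥0∞} (hh : ∀ k, Measurable (h k)) (n : ℕ) (t : ℝ≥0)
    (x : Space d) : killed P D t (fun z => ∑ k ∈ Finset.range n, h k z) x =
      ∑ k ∈ Finset.range n, killed P D t (h k) x :=
  lintegral_finsetSum _ fun k _ => (hh k).comp (measurable_X t)

theorem killed_tsum {h : ℕ → Space d → ℝ≥0∞} (hh : ∀ k, Measurable (h k)) (t : ℝ≥0)
    (x : Space d) : killed P D t (fun z => ∑' k, h k z) x = ∑' k, killed P D t (h k) x :=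
  lintegral_tsum fun k => ((hh k).comp (measurable_X t)).aemeasurable

theorem killed_eq_lintegral_indicator (t : ℝ≥0) (h : Space d → ℝ≥0∞) (x : Space d) :
    killed P D t h x =
      ∫⁻ ω, {ω | (t : ℝ≥0∞) < reach D 0 ω}.indicator (fun ω => h (X t ω)) ω ∂(P x) := by
  rw [killed, ← lintegral_indicator (measurableSet_alive' t)]
  simp only [lt_reach_iff]

theorem measurable_indicator_alive {h : Space d → ℝ≥0∞} (hh : Measurable h) :
    Measurable fun p : ℝ × Path d => {ω | ((p.1.toNNReal : ℝ≥0) : ℝ≥0∞) < reach D 0 ω}.indicator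
      (fun ω => h (X p.1.toNNReal ω)) p.2 := by
  have h1 : MeasurableSet {p : ℝ × Path d | ((p.1.toNNReal : ℝ≥0) : ℝ≥0∞) < reach D 0 p.2} :=
    measurableSet_lt (measurable_fst.real_toNNReal.coe_nnreal_ennreal)
      ((measurable_reach 0).comp measurable_snd)
  have h2 : Measurable fun p : ℝ × Path d => h (X p.1.toNNReal p.2) :=
    hh.comp (measurable_X_uncurry.comp (measurable_fst.real_toNNReal.prodMk measurable_snd))
  exact h2.indicator h1

theorem measurable_killed_time [IsMarkovKernel P] {h : Space d → ℝ≥0∞} (hh : Measurable h)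
    (x : Space d) : Measurable fun t : ℝ => killed P D t.toNNReal h x := by
  simp only [killed_eq_lintegral_indicator]
  exact (measurable_indicator_alive hh).lintegral_prod_right'

theorem Coeffs.IsStrongMarkovSolution.isMarkovKernel (hP : a.IsStrongMarkovSolution P) :
    IsMarkovKernel P := ⟨fun x => (hP.solves x).prob⟩

/-- The Markov property at a fixed time, on an event of the past. -/
theorem Coeffs.IsStrongMarkovSolution.setLIntegral_shift (hP : a.IsStrongMarkovSolution P)
    (x : Space d) (s : ℝ≥0) {A : Set (Path d)} (hA : MeasurableSet[natFiltration d s] A)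
    {G : Path d → ℝ≥0∞} (hG : Measurable G) :
    ∫⁻ ω in A, G (shift s ω) ∂(P x) = ∫⁻ ω in A, ∫⁻ ω', G ω' ∂(P (X s ω)) ∂(P x) := by
  have hmeas : ((P x).restrict A).map (shift s) = (((P x).restrict A).map (X s)).bind P := by
    ext B hB
    rw [Measure.map_apply (measurable_shift s) hB,
      Measure.restrict_apply (measurable_shift s hB), Measure.bind_apply hB P.aemeasurable,
      lintegral_map (P.measurable_coe hB) (measurable_X s), Set.inter_comm]
    exact hP.strongMarkov x (fun _ => (s : WithTop ℝ≥0)) (isStoppingTime_const _ s) A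
      (by rw [IsStoppingTime.measurableSpace_const]; exact hA) (fun ω _ => WithTop.coe_ne_top) B hB
  rw [← lintegral_map hG (measurable_shift s), hmeas,
    Measure.lintegral_bind P.aemeasurable hG.aemeasurable,
    lintegral_map hG.lintegral_kernel (measurable_X s)]

/-- The semigroup property. -/
theorem killed_add (hP : a.IsStrongMarkovSolution P) {h : Space d → ℝ≥0∞} (hh : Measurable h)
    (s t : ℝ≥0) (x : Space d) : killed P D (s + t) h x = killed P D s (killed P D t h) x := by
  have hset : {ω : Path d | 0 < runMin D (s + t) ω} =
      shift s ⁻¹' {ω | 0 < runMin D t ω} ∩ {ω | 0 < runMin D s ω} := by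
    ext ω
    simp only [Set.mem_ofPred_eq, Set.mem_inter_iff, Set.mem_preimage, runMin_add, lt_min_iff,
      and_comm]
  have hG : Measurable ({ω : Path d | 0 < runMin D t ω}.indicator fun ω => h (X t ω)) :=
    (hh.comp (measurable_X t)).indicator (measurableSet_alive' t)
  have h1 := hP.setLIntegral_shift x s (measurableSet_alive (D := D) s) hG
  simp only [lintegral_indicator (measurableSet_alive' t)] at h1
  unfold killed
  rw [← h1, hset, ← Measure.restrict_restrict (measurable_shift s (measurableSet_alive' t)),
    ← lintegral_indicator (measurable_shift s (measurableSet_alive' t))]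
  rfl

theorem killed_one_le [IsMarkovKernel P] (t : ℝ≥0) (x : Space d) :
    killed P D t (fun _ => 1) x ≤ 1 := by
  rw [killed, setLIntegral_one]
  exact prob_le_one

theorem killed_one_anti {s t : ℝ≥0} (h : s ≤ t) (x : Space d) :
    killed P D t (fun _ => 1) x ≤ killed P D s (fun _ => 1) x := by
  rw [killed, killed, setLIntegral_one, setLIntegral_one]
  exact measure_mono fun ω hω => lt_of_lt_of_le hω (runMin_anti h ω)

theorem killed_zero_eq (hP : a.IsStrongMarkovSolution P) (hD : IsOpen D) (hD' : Dᶜ.Nonempty)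
    (h : Space d → ℝ≥0∞) {x : Space d} (hx : x ∈ D) : killed P D 0 h x = h x := by
  have := hP.isMarkovKernel
  have h0 : ∀ᵐ ω ∂(P x), {ω : Path d | 0 < runMin D 0 ω}.indicator (fun ω => h (X 0 ω)) ω =
      h x := by
    filter_upwards [ae_initial (hP.solves x)] with ω hω
    rw [Set.indicator_of_mem, hω]
    refine (gap_pos hD hD' hx).trans_le (le_runMin fun s hs => ?_)
    rw [nonpos_iff_eq_zero.1 hs, hω]
  rw [killed, ← lintegral_indicator (measurableSet_alive' 0), lintegral_congr_ae h0]
  simp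

/-- The process is killed in finite time. -/
theorem tendsto_killed_one (hP : a.IsStrongMarkovSolution P) (hET : FiniteExit P D) {x : Space d}
    (hx : x ∈ D) : Tendsto (fun n : ℕ => killed P D n (fun _ => 1) x) atTop (𝓝 0) := by
  have := hP.isMarkovKernel
  have h1 : ∀ n : ℕ, killed P D n (fun _ => 1) x = P x {ω | 0 < runMin D n ω} := fun n => by
    rw [killed, setLIntegral_one]
  simp only [h1]
  have h2 : P x (⋂ n : ℕ, {ω | 0 < runMin D n ω}) = 0 := by
    rw [measure_eq_zero_iff_ae_notMem]
    filter_upwards [hET x hx] with ω hω hmem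
    obtain ⟨n, hn⟩ := exists_nat_gt (exitTime D ω).toNNReal
    have h3 : ((n : ℝ≥0) : ℝ≥0∞) < reach D 0 ω := lt_reach_iff.2 (Set.mem_iInter.1 hmem n)
    have h4 := h3.trans_le (reach_le_exitTime ω)
    rw [← ENNReal.coe_toNNReal hω.ne] at h4
    exact lt_asymm hn (ENNReal.coe_lt_coe.1 h4)
  rw [← h2]
  exact tendsto_measure_iInter_atTop (fun n => (measurableSet_alive' _).nullMeasurableSet)
    (fun m n hmn ω hω => lt_of_lt_of_le hω (runMin_anti (by exact_mod_cast hmn) ω))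
    ⟨0, measure_ne_top _ _⟩

/-- `exitTime` need not be measurable, but it agrees almost surely with `reach D 0`, so that the
semigroup of `D` is the killed semigroup. -/
theorem semigroup_eq_killed (hP : a.IsStrongMarkovSolution P) (hD : IsOpen D) (hD' : Dᶜ.Nonempty)
    (h1 : a.Local D) (h2 : a.Levy) {x : Space d} (hx : x ∈ D) (t : ℝ≥0) {f : Space d → ℝ}
    {h : Space d → ℝ≥0∞} (hf : ∀ z ∈ D, ENNReal.ofReal (f z) = h z) :
    semigroup P D t f x = killed P D t h x := by
  rw [killed_eq_lintegral_indicator, semigroup]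
  refine lintegral_congr_ae ?_
  filter_upwards [ae_exitTime_eq hD hD' h1 h2 hx (hP.solves x)] with ω hω
  by_cases hlt : (t : ℝ≥0∞) < reach D 0 ω
  · have hlt' : (t : ℝ≥0∞) < exitTime D ω := hω ▸ hlt
    rw [Set.indicator_of_mem (by exact hlt'), Set.indicator_of_mem (by exact hlt)]
    exact hf _ (mem_of_alive (lt_reach_iff.1 hlt))
  · have hlt' : ¬ (t : ℝ≥0∞) < exitTime D ω := hω ▸ hlt
    rw [Set.indicator_of_notMem (by exact hlt'), Set.indicator_of_notMem (by exact hlt)]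

/-! ### Supermedian functions dominate potentials -/

/-- The probability of being killed between the times `j` and `j + 1`. -/
noncomputable def killedBetween (P : Kernel (Space d) (Path d)) (D : Set (Space d)) (j : ℕ)
    (x : Space d) : ℝ≥0∞ :=
  killed P D j (fun _ => 1) x - killed P D (j + 1 : ℕ) (fun _ => 1) x

theorem measurable_killedBetween (j : ℕ) : Measurable (killedBetween P D j) :=
  (measurable_killed measurable_const _).sub (measurable_killed measurable_const _)

theorem killedBetween_add (j : ℕ) (x : Space d) :
    killedBetween P D j x + killed P D (j + 1 : ℕ) (fun _ => 1) x = killed P D j (fun _ => 1) x :=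
  tsub_add_cancel_of_le (killed_one_anti (by exact_mod_cast Nat.le_succ j) x)

theorem killedBetween_le_one [IsMarkovKernel P] (j : ℕ) (x : Space d) :
    killedBetween P D j x ≤ 1 := tsub_le_self.trans (killed_one_le _ x)

theorem sum_killedBetween (n : ℕ) (x : Space d) :
    ∑ j ∈ Finset.range n, killedBetween P D j x + killed P D n (fun _ => 1) x =
      killed P D (0 : ℕ) (fun _ => 1) x := by
  induction n with
  | zero => simp
  | succ n ih => rw [Finset.sum_range_succ, add_assoc, killedBetween_add, ih]

theorem tsum_killedBetween (hP : a.IsStrongMarkovSolution P) (hD : IsOpen D) (hD' : Dᶜ.Nonempty)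
    (hET : FiniteExit P D) {x : Space d} (hx : x ∈ D) : ∑' j, killedBetween P D j x = 1 := by
  have h1 := (ENNReal.tendsto_nat_tsum fun j => killedBetween P D j x).add
    (tendsto_killed_one hP hET hx)
  simp only [sum_killedBetween, add_zero] at h1
  rw [tendsto_nhds_unique h1 tendsto_const_nhds, Nat.cast_zero, killed_zero_eq hP hD hD' _ hx]

/-- The discrete-time potential of `killedBetween P D j` telescopes. -/
theorem sum_killed_killedBetween (hP : a.IsStrongMarkovSolution P) (j n : ℕ) (x : Space d) :
    ∑ k ∈ Finset.range n, killed P D k (killedBetween P D j) x +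
      killed P D n (killed P D j fun _ => 1) x =
        killed P D (0 : ℕ) (killed P D j fun _ => 1) x := by
  induction n with
  | zero => simp
  | succ n ih =>
    have h1 : killed P D (n + 1 : ℕ) (killed P D j fun _ => 1) x =
        killed P D n (killed P D (j + 1 : ℕ) fun _ => 1) x := by
      rw [← killed_add hP measurable_const, ← killed_add hP measurable_const]
      congr 1; push_cast; ring
    rw [Finset.sum_range_succ, add_assoc, h1, ← killed_add_fun (measurable_killedBetween j),
      funext (killedBetween_add (P := P) (D := D) j), ih]

/-- `v` is supermedian for the semigroup discounted at rate `α`. -/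
def Supermedian (P : Kernel (Space d) (Path d)) (D : Set (Space d)) (α : ℝ)
    (v : Space d → ℝ≥0∞) : Prop :=
  ∀ t : ℝ≥0, ∀ x ∈ D, ENNReal.ofReal (Real.exp (-α * t)) * killed P D t v x ≤ v x

/-- The part of `killedBetween P D j` on the superlevel set `{δ ≤ v}`, scaled by `δ`. -/
noncomputable def levelSource (P : Kernel (Space d) (Path d)) (D : Set (Space d)) (j : ℕ)
    (v : Space d → ℝ≥0∞) (δ : ℝ≥0∞) : Space d → ℝ≥0∞ :=
  {z | δ ≤ v z}.indicator fun z => δ * killedBetween P D j z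

theorem measurable_levelSource (j : ℕ) {v : Space d → ℝ≥0∞} (hv : Measurable v) (δ : ℝ≥0∞) :
    Measurable (levelSource P D j v δ) :=
  ((measurable_killedBetween j).const_mul δ).indicator (measurableSet_le measurable_const hv)

theorem exp_neg_le_one {α s : ℝ} (hα : 0 ≤ α) (hs : 0 ≤ s) :
    ENNReal.ofReal (Real.exp (-α * s)) ≤ 1 := by
  rw [ENNReal.ofReal_le_one, Real.exp_le_one_iff]
  nlinarith

theorem exp_neg_add (α s t : ℝ) : ENNReal.ofReal (Real.exp (-α * (s + t))) =
    ENNReal.ofReal (Real.exp (-α * s)) * ENNReal.ofReal (Real.exp (-α * t)) := by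
  rw [mul_add, Real.exp_add, ENNReal.ofReal_mul (Real.exp_nonneg _)]

/-- Domination principle for the discrete-time potential: on `{δ ≤ v}` it is at most `δ`, and
elsewhere its partial sums are carried over from the preceding ones by the semigroup. -/
theorem sum_killed_levelSource_le (hP : a.IsStrongMarkovSolution P) (hD : IsOpen D)
    (hD' : Dᶜ.Nonempty) {α : ℝ} (hα : 0 ≤ α) {v : Space d → ℝ≥0∞} (hv : Measurable v)
    (hsup : Supermedian P D α v) (j : ℕ) (δ : ℝ≥0∞) (n : ℕ) :
    ∀ x ∈ D, ∑ k ∈ Finset.range n, ENNReal.ofReal (Real.exp (-α * k)) *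
      killed P D k (levelSource P D j v δ) x ≤ v x := by
  have := hP.isMarkovKernel
  have hmf := measurable_levelSource (P := P) (D := D) j hv δ
  have hlevel : ∀ n : ℕ, ∀ x ∈ D, ∑ k ∈ Finset.range n, ENNReal.ofReal (Real.exp (-α * k)) *
      killed P D k (levelSource P D j v δ) x ≤ δ := by
    intro n x hx
    calc ∑ k ∈ Finset.range n, ENNReal.ofReal (Real.exp (-α * k)) *
          killed P D k (levelSource P D j v δ) x
        ≤ ∑ k ∈ Finset.range n, δ * killed P D k (killedBetween P D j) x := by
          refine Finset.sum_le_sum fun k _ => ?_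
          refine (mul_le_of_le_one_left' (exp_neg_le_one hα k.cast_nonneg)).trans ?_
          rw [← killed_const_mul (measurable_killedBetween j)]
          exact killed_mono (fun z _ => Set.indicator_le_self _ _ z) _ _
      _ = δ * ∑ k ∈ Finset.range n, killed P D k (killedBetween P D j) x :=
          (Finset.mul_sum _ _ _).symm
      _ ≤ δ * 1 := by
          gcongr
          refine le_self_add.trans ((sum_killed_killedBetween hP j n x).le.trans ?_)
          rw [Nat.cast_zero, killed_zero_eq hP hD hD' _ hx]
          exact killed_one_le _ x
      _ = δ := mul_one δ
  induction n with
  | zero => simp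
  | succ n ih =>
    intro x hx
    by_cases hδ : δ ≤ v x
    · exact (hlevel (n + 1) x hx).trans hδ
    have h0 : levelSource P D j v δ x = 0 := Set.indicator_of_notMem (by exact hδ) _
    rw [Finset.sum_range_succ']
    have hlast : ENNReal.ofReal (Real.exp (-α * (0 : ℕ))) *
        killed P D (0 : ℕ) (levelSource P D j v δ) x = 0 := by
      rw [Nat.cast_zero (R := ℝ≥0), killed_zero_eq hP hD hD' _ hx, h0, mul_zero]
    rw [hlast, add_zero]
    have hstep : ∀ k : ℕ, ENNReal.ofReal (Real.exp (-α * (k + 1 : ℕ))) *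
        killed P D (k + 1 : ℕ) (levelSource P D j v δ) x = ENNReal.ofReal (Real.exp (-α * 1)) *
          killed P D 1 (fun z => ENNReal.ofReal (Real.exp (-α * k)) *
            killed P D k (levelSource P D j v δ) z) x := by
      intro k
      rw [killed_const_mul (measurable_killed hmf _), ← killed_add hP hmf, ← mul_assoc,
        ← exp_neg_add]
      push_cast
      rw [add_comm (k : ℝ), add_comm (k : ℝ≥0)]
    simp only [hstep]
    rw [← Finset.mul_sum, ← killed_sum fun k => (measurable_killed hmf _).const_mul _]
    refine le_trans ?_ (hsup 1 x hx)
    rw [NNReal.coe_one]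
    gcongr
    exact killed_mono ih _ _

/-- Domination principle in continuous time: a supermedian function dominates the potential of
`levelSource`. The potential is the discrete-time one averaged over the offsets in `(0, 1]`. -/
theorem lintegral_killed_levelSource_le (hP : a.IsStrongMarkovSolution P) (hD : IsOpen D)
    (hD' : Dᶜ.Nonempty) {α : ℝ} (hα : 0 ≤ α) {v : Space d → ℝ≥0∞} (hv : Measurable v)
    (hsup : Supermedian P D α v) (j : ℕ) (δ : ℝ≥0∞) {x : Space d} (hx : x ∈ D) :
    ∫⁻ t in Set.Ioi (0 : ℝ), ENNReal.ofReal (Real.exp (-α * t)) *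
      killed P D t.toNNReal (levelSource P D j v δ) x ≤ v x := by
  have := hP.isMarkovKernel
  have hmf := measurable_levelSource (P := P) (D := D) j hv δ
  set f := levelSource P D j v δ with hf
  set F : ℝ → ℝ≥0∞ := fun t => ENNReal.ofReal (Real.exp (-α * t)) * killed P D t.toNNReal f x
    with hF
  have hFm : Measurable F :=
    (by fun_prop : Measurable fun t : ℝ => ENNReal.ofReal (Real.exp (-α * t))).mul
      (measurable_killed_time hmf x)
  have hcover : Set.Ioi (0 : ℝ) ⊆ ⋃ k : ℕ, Set.Ioc (k : ℝ) (k + 1) := by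
    intro t ht
    have h1 : 0 < ⌈t⌉₊ := Nat.ceil_pos.2 ht
    refine Set.mem_iUnion.2 ⟨⌈t⌉₊ - 1, Nat.lt_ceil.1 (by omega), ?_⟩
    have h2 : ((⌈t⌉₊ - 1 : ℕ) : ℝ) + 1 = ⌈t⌉₊ := by exact_mod_cast Nat.sub_add_cancel h1
    rw [h2]
    exact Nat.le_ceil t
  have hshift : ∀ k : ℕ, ∫⁻ t in Set.Ioc (k : ℝ) (k + 1), F t =
      ∫⁻ s in Set.Ioc (0 : ℝ) 1, F (s + k) := by
    intro k
    rw [← (measurePreserving_add_right volume (k : ℝ)).setLIntegral_comp_preimage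
      measurableSet_Ioc hFm]
    simp
  have hterm : ∀ s ∈ Set.Ioc (0 : ℝ) 1, ∑' k : ℕ, F (s + k) ≤ v x := by
    intro s hs
    have h1 : ∀ k : ℕ, F (s + k) = ENNReal.ofReal (Real.exp (-α * s)) *
        killed P D s.toNNReal (fun z => ENNReal.ofReal (Real.exp (-α * k)) *
          killed P D k f z) x := by
      intro k
      rw [killed_const_mul (measurable_killed hmf _), ← killed_add hP hmf, ← mul_assoc,
        ← exp_neg_add]
      simp only [hF]
      rw [Real.toNNReal_add hs.1.le k.cast_nonneg, Real.toNNReal_natCast]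
    simp only [h1]
    rw [ENNReal.tsum_mul_left, ← killed_tsum fun k => (measurable_killed hmf _).const_mul _]
    refine le_trans ?_ (hsup s.toNNReal x hx)
    rw [Real.coe_toNNReal s hs.1.le]
    gcongr
    refine killed_mono (fun z hz => ?_) _ _
    rw [ENNReal.tsum_eq_iSup_nat]
    exact iSup_le fun n => sum_killed_levelSource_le hP hD hD' hα hv hsup j δ n z hz
  calc ∫⁻ t in Set.Ioi (0 : ℝ), F t
      ≤ ∫⁻ t in ⋃ k : ℕ, Set.Ioc (k : ℝ) (k + 1), F t := lintegral_mono_set hcover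
    _ ≤ ∑' k : ℕ, ∫⁻ t in Set.Ioc (k : ℝ) (k + 1), F t := lintegral_iUnion_le _ _
    _ = ∑' k : ℕ, ∫⁻ s in Set.Ioc (0 : ℝ) 1, F (s + k) := by simp only [hshift]
    _ = ∫⁻ s in Set.Ioc (0 : ℝ) 1, ∑' k : ℕ, F (s + k) :=
        (lintegral_tsum fun k => (hFm.comp (measurable_id.add_const _)).aemeasurable).symm
    _ ≤ ∫⁻ _s in Set.Ioc (0 : ℝ) 1, v x := setLIntegral_mono' measurableSet_Ioc hterm
    _ = v x := by simp

end

section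

variable {d : ℕ} {D : Set (Space d)} {a : Coeffs d} {P : Kernel (Space d) (Path d)}

/-! ### Weak subsolutions and supermedian functions -/

theorem measurable_indicator_of_subtype {E : Type*} [MeasurableSpace E] [Zero E]
    {h : Space d → E} (hD : IsOpen D) (hh : Measurable fun x : D => h x) :
    Measurable (D.indicator h) := by
  refine measurable_of_restrict_of_restrict_compl hD.measurableSet
    ?_ ?_
  · convert hh using 2 with x
    exact Set.indicator_of_mem x.2 h
  · convert (measurable_const : Measurable fun _ : (Dᶜ : Set (Space d)) => (0 : E)) using 2 with x
    exact Set.indicator_of_notMem x.2 h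

theorem le_supOn {c : Space d → ℝ} (hc : BddNonnegBorel D c) {z : Space d} (hz : z ∈ D) :
    c z ≤ supOn D c := by
  obtain ⟨C, hC⟩ := hc.bounded
  exact le_csSup ⟨C, by rintro _ ⟨w, hw, rfl⟩; exact hC w hw⟩ ⟨z, hz, rfl⟩

theorem indicator_nonneg_of_bddNonneg {c : Space d → ℝ} (hc : BddNonnegBorel D c) (z : Space d) :
    0 ≤ D.indicator c z := Set.indicator_nonneg hc.nonneg z

theorem supOn_nonneg {c : Space d → ℝ} (hc : BddNonnegBorel D c) : 0 ≤ supOn D c :=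
  Real.sSup_nonneg (by rintro _ ⟨w, hw, rfl⟩; exact hc.nonneg w hw)

theorem indicator_le_supOn {c : Space d → ℝ} (hc : BddNonnegBorel D c) (z : Space d) :
    D.indicator c z ≤ supOn D c := by
  by_cases hz : z ∈ D
  · rw [Set.indicator_of_mem hz]; exact le_supOn hc hz
  · rw [Set.indicator_of_notMem hz]; exact supOn_nonneg hc

/-- The killing cost `∫_0^σ c(X_r) dr` accumulated up to `σ = reach D 0 ∧ t`. -/
noncomputable def cost (D : Set (Space d)) (c : Space d → ℝ) (t : ℝ≥0) (ω : Path d) : ℝ :=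
  ∫ r in Set.Ioc (0 : ℝ) (stopAt D 0 t ω), D.indicator c (X r.toNNReal ω)

theorem cost_nonneg {c : Space d → ℝ} (hc : BddNonnegBorel D c) (t : ℝ≥0) (ω : Path d) :
    0 ≤ cost D c t ω :=
  setIntegral_nonneg measurableSet_Ioc fun _ _ => indicator_nonneg_of_bddNonneg hc _

theorem measurable_indicator_path {c : Space d → ℝ} (hD : IsOpen D) (hc : BddNonnegBorel D c)
    (ω : Path d) : Measurable fun r : ℝ => D.indicator c (X r.toNNReal ω) :=
  (measurable_indicator_of_subtype hD hc.measurable).comp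
    (measurable_X_uncurry.comp (measurable_real_toNNReal.prodMk measurable_const))

theorem integrableOn_indicator_path {c : Space d → ℝ} (hD : IsOpen D) (hc : BddNonnegBorel D c)
    (ω : Path d) (s : ℝ) :
    IntegrableOn (fun r : ℝ => D.indicator c (X r.toNNReal ω)) (Set.Ioc 0 s) :=
  Measure.integrableOn_of_bounded (M := supOn D c) (by simp)
    (measurable_indicator_path hD hc ω).aestronglyMeasurable
    (.of_forall fun r => by
      rw [Real.norm_of_nonneg (indicator_nonneg_of_bddNonneg hc _)]
      exact indicator_le_supOn hc _)

theorem cost_le {c : Space d → ℝ} (hD : IsOpen D) (hc : BddNonnegBorel D c) (t : ℝ≥0)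
    (ω : Path d) : cost D c t ω ≤ supOn D c * t := by
  have h1 : cost D c t ω ≤ ∫ _r in Set.Ioc (0 : ℝ) (stopAt D 0 t ω), supOn D c :=
    setIntegral_mono_on (integrableOn_indicator_path hD hc ω _) (by simp) measurableSet_Ioc
      fun r _ => indicator_le_supOn hc _
  have h2 : (stopAt D 0 t ω : ℝ) ≤ t := stopAt_le 0 t ω
  refine h1.trans ?_
  simp only [integral_const, smul_eq_mul, MeasurableSet.univ, measureReal_restrict_apply,
    Set.univ_inter, Real.volume_real_Ioc, sub_zero]
  rw [max_eq_left (NNReal.coe_nonneg _), mul_comm]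
  exact mul_le_mul_of_nonneg_left h2 (supOn_nonneg hc)

theorem measurable_cost {c : Space d → ℝ} (hD : IsOpen D) (hc : BddNonnegBorel D c) (t : ℝ≥0) :
    Measurable (cost D c t) := by
  have h1 : MeasurableSet {p : Path d × ℝ | 0 < p.2 ∧ p.2 ≤ stopAt D 0 t p.1} :=
    (measurableSet_lt measurable_const measurable_snd).inter
      (measurableSet_le measurable_snd
        ((measurable_stopAt 0 t).comp measurable_fst).coe_nnreal_real)
  have h2 : Measurable fun p : Path d × ℝ => D.indicator c (X p.2.toNNReal p.1) :=
    (measurable_indicator_of_subtype hD hc.measurable).comp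
      (measurable_X_uncurry.comp (measurable_snd.real_toNNReal.prodMk measurable_fst))
  have h3 := ((h2.indicator h1).stronglyMeasurable.integral_prod_right' (ν := volume)).measurable
  convert h3 using 2 with ω
  rw [cost, ← integral_indicator measurableSet_Ioc]
  rfl

/-- Before the contact time the path is in `D`, so values of `c` off `D` do not enter. -/
theorem discount_stopAt {c : Space d → ℝ} (t : ℝ≥0) (ω : Path d) :
    discount c (stopAt D 0 t ω) ω = Real.exp (-cost D c t ω) := by
  unfold discount cost
  rw [intervalIntegral.integral_of_le (NNReal.coe_nonneg _)]
  congr 2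
  refine setIntegral_congr_ae measurableSet_Ioc ?_
  have h0 : ∀ᵐ r : ℝ, r ≠ (stopAt D 0 t ω : ℝ) := by simp [ae_iff]
  filter_upwards [h0] with r hr hmem
  rw [Set.indicator_of_mem (mem_of_lt_stopAt_real le_rfl (lt_of_le_of_ne hmem.2 hr) hmem.1.le)]

theorem le_supOn_of_mem {u : Space d → ℝ} {C : ℝ} (hC : ∀ x, |u x| ≤ C) {z : Space d}
    (hz : z ∈ D) : u z ≤ supOn (a.extDomain D) u :=
  le_csSup ⟨C, by rintro _ ⟨w, _, rfl⟩; exact (le_abs_self _).trans (hC w)⟩ ⟨z, Or.inr hz, rfl⟩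

/-- The subsolution inequality, with the source dropped, gives lower bounds for `sup u - u`. -/
theorem lintegral_le_sup_sub (hD : IsOpen D) (hD' : Dᶜ.Nonempty) (h1 : a.Local D) (h2 : a.Levy)
    (hP : a.IsStrongMarkovSolution P) {c g u : Space d → ℝ} (hc : BddNonnegBorel D c)
    (hu : IsWeakSubsolution P D c g u) (hM : 0 ≤ supOn (a.extDomain D) u) {x : Space d}
    (hx : x ∈ D) (t : ℝ≥0) {H : Path d → ℝ≥0∞}
    (hH : ∀ ω, u (X (stopAt D 0 t ω) ω) ≤ supOn (a.extDomain D) u →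
      H ω ≤ ENNReal.ofReal (supOn (a.extDomain D) u -
        Real.exp (-cost D c t ω) * u (X (stopAt D 0 t ω) ω))) :
    ∫⁻ ω, H ω ∂(P x) ≤ ENNReal.ofReal (supOn (a.extDomain D) u - u x) := by
  have := (hP.solves x).prob
  obtain ⟨C, hC⟩ := hu.bounded
  set M := supOn (a.extDomain D) u
  have hexit : ∀ᵐ ω ∂(P x), exitMin D t ω = stopAt D 0 t ω := by
    filter_upwards [ae_exitTime_eq hD hD' h1 h2 hx (hP.solves x)] with ω hω
    rw [exitMin, stopAt, hω]
  have hle := ae_le_supOn hD h2 hx (hP.solves x) hu.measurable hC t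
  have hexp1 : ∀ ω, Real.exp (-cost D c t ω) ≤ 1 := fun ω =>
    Real.exp_le_one_iff.2 (neg_nonpos.2 (cost_nonneg hc t ω))
  have hi : Integrable (fun ω => Real.exp (-cost D c t ω) * u (X (stopAt D 0 t ω) ω)) (P x) := by
    refine .of_bound (C := C) ?_ (.of_forall fun ω => ?_)
    · exact ((measurable_cost hD hc t).neg.exp.mul
        (hu.measurable.comp (measurable_X_comp (measurable_stopAt 0 t)))).aestronglyMeasurable
    · rw [norm_mul, Real.norm_of_nonneg (Real.exp_nonneg _)]
      exact (mul_le_of_le_one_left (norm_nonneg _) (hexp1 ω)).trans (hC _)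
  have hu1 : u x ≤ ∫ ω, Real.exp (-cost D c t ω) * u (X (stopAt D 0 t ω) ω) ∂(P x) := by
    refine (hu.le x hx t).trans ((sub_le_self _ ENNReal.toReal_nonneg).trans_eq ?_)
    refine integral_congr_ae ?_
    filter_upwards [hexit] with ω hω
    rw [hω, discount_stopAt]
  have hnn : 0 ≤ᵐ[P x] fun ω => M - Real.exp (-cost D c t ω) * u (X (stopAt D 0 t ω) ω) := by
    filter_upwards [hle] with ω hω
    have := Real.exp_nonneg (-cost D c t ω)
    change 0 ≤ M - _
    nlinarith [hexp1 ω, mul_le_mul_of_nonneg_left hω this]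
  calc ∫⁻ ω, H ω ∂(P x)
      ≤ ∫⁻ ω, ENNReal.ofReal (M - Real.exp (-cost D c t ω) * u (X (stopAt D 0 t ω) ω)) ∂(P x) :=
        lintegral_mono_ae (hle.mono fun ω hω => hH ω hω)
    _ = ENNReal.ofReal (∫ ω, (M - Real.exp (-cost D c t ω) * u (X (stopAt D 0 t ω) ω)) ∂(P x)) :=
        (ofReal_integral_eq_lintegral_ofReal ((integrable_const _).sub hi) hnn).symm
    _ ≤ ENNReal.ofReal (M - u x) := by
        rw [integral_sub (integrable_const _) hi, integral_const, probReal_univ, one_smul]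
        exact ENNReal.ofReal_le_ofReal (by linarith)

/-- For a weak subsolution `u`, the function `sup u - u` is supermedian at the rate `sup c`. -/
theorem supermedian_sup_sub (hD : IsOpen D) (hD' : Dᶜ.Nonempty) (h1 : a.Local D) (h2 : a.Levy)
    (hP : a.IsStrongMarkovSolution P) {c g u : Space d → ℝ} (hc : BddNonnegBorel D c)
    (hu : IsWeakSubsolution P D c g u) (hM : 0 ≤ supOn (a.extDomain D) u) :
    Supermedian P D (supOn D c) fun z => ENNReal.ofReal (supOn (a.extDomain D) u - u z) := by
  intro t x hx
  have hm : Measurable fun z => ENNReal.ofReal (supOn (a.extDomain D) u - u z) :=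
    (hu.measurable.const_sub _).ennreal_ofReal
  rw [← killed_const_mul hm, killed, ← lintegral_indicator (measurableSet_alive' t)]
  refine lintegral_le_sup_sub hD hD' h1 h2 hP hc hu hM hx t fun ω hω => ?_
  by_cases hal : 0 < runMin D t ω
  · rw [Set.indicator_of_mem (by exact hal), ← ENNReal.ofReal_mul (Real.exp_nonneg _)]
    rw [stopAt_eq_right hal] at hω ⊢
    refine ENNReal.ofReal_le_ofReal ?_
    have h3 : Real.exp (-supOn D c * t) ≤ Real.exp (-cost D c t ω) := by
      rw [Real.exp_le_exp, neg_mul]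
      exact neg_le_neg (cost_le hD hc t ω)
    have h4 : Real.exp (-cost D c t ω) ≤ 1 :=
      Real.exp_le_one_iff.2 (neg_nonpos.2 (cost_nonneg hc t ω))
    nlinarith [mul_le_mul_of_nonneg_right h3 (sub_nonneg.2 hω)]
  · rw [Set.indicator_of_notMem (by exact hal)]
    exact zero_le

/-- `1 - e^{-s}` dominates half of `min s 1`. -/
theorem half_min_le_one_sub_exp {s : ℝ} (hs : 0 ≤ s) : 1 / 2 * min s 1 ≤ 1 - Real.exp (-s) := by
  have h1 : Real.exp (-s) ≤ 1 / (1 + s) := by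
    rw [Real.exp_neg, ← one_div]
    exact one_div_le_one_div_of_le (by positivity) (by linarith [Real.add_one_le_exp s])
  have h2 : 1 / 2 * min s 1 ≤ 1 - 1 / (1 + s) := by
    rw [le_sub_iff_add_le, ← le_sub_iff_add_le', div_le_iff₀ (by positivity)]
    rcases le_total s 1 with h | h
    · rw [min_eq_left h]; nlinarith
    · rw [min_eq_right h]; nlinarith
  linarith

theorem lintegral_discounted_const_le_one {α : ℝ} (hα : 0 ≤ α) :
    ∫⁻ r in Set.Ioi (0 : ℝ), ENNReal.ofReal (Real.exp (-α * r)) * ENNReal.ofReal α ≤ 1 := by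
  rcases hα.eq_or_lt with rfl | hpos
  · simp
  · have h1 := integral_exp_mul_Ioi (neg_lt_zero.2 hpos) 0
    have h2 := integrableOn_exp_mul_Ioi (neg_lt_zero.2 hpos) 0
    rw [lintegral_mul_const _ (by fun_prop), ← ofReal_integral_eq_lintegral_ofReal h2
      (.of_forall fun r => Real.exp_nonneg _), h1, ← ENNReal.ofReal_mul (by simp [hpos.le])]
    simp [hpos.ne']

/-- Along each path, the discounted integral of `c` is controlled by `1 - e^{-cost}`. -/
theorem lintegral_discounted_le {c : Space d → ℝ} (hD : IsOpen D) (hc : BddNonnegBorel D c)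
    (t : ℝ≥0) (ω : Path d) :
    ∫⁻ r in Set.Ioc (0 : ℝ) t, ENNReal.ofReal (Real.exp (-supOn D c * r)) *
      {ω | ((r.toNNReal : ℝ≥0) : ℝ≥0∞) < reach D 0 ω}.indicator
        (fun ω => ENNReal.ofReal (D.indicator c (X r.toNNReal ω))) ω ≤
      ENNReal.ofReal (min (cost D c t ω) 1) := by
  have hα := supOn_nonneg hc
  rw [ENNReal.ofReal_min, ENNReal.ofReal_one]
  refine le_min ?_ ?_
  · have h1 : ENNReal.ofReal (cost D c t ω) = ∫⁻ r in Set.Ioc (0 : ℝ) (stopAt D 0 t ω),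
        ENNReal.ofReal (D.indicator c (X r.toNNReal ω)) :=
      ofReal_integral_eq_lintegral_ofReal (integrableOn_indicator_path hD hc ω _)
        (.of_forall fun r => indicator_nonneg_of_bddNonneg hc _)
    rw [h1, ← lintegral_indicator measurableSet_Ioc, ← lintegral_indicator measurableSet_Ioc]
    refine lintegral_mono fun r => ?_
    by_cases hr : r ∈ Set.Ioc (0 : ℝ) t
    · rw [Set.indicator_of_mem hr]
      by_cases hlt : ((r.toNNReal : ℝ≥0) : ℝ≥0∞) < reach D 0 ω
      · have hmem : r ∈ Set.Ioc (0 : ℝ) (stopAt D 0 t ω) := by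
          refine ⟨hr.1, ?_⟩
          rw [← Real.coe_toNNReal r hr.1.le, NNReal.coe_le_coe, ← ENNReal.coe_le_coe, coe_stopAt]
          exact le_min hlt.le (ENNReal.coe_le_coe.2 (Real.toNNReal_le_iff_le_coe.2 hr.2))
        rw [Set.indicator_of_mem hmem, Set.indicator_of_mem (by exact hlt)]
        exact mul_le_of_le_one_left' (exp_neg_le_one hα hr.1.le)
      · rw [Set.indicator_of_notMem (by exact hlt), mul_zero]; exact zero_le
    · rw [Set.indicator_of_notMem hr]; exact zero_le
  · refine le_trans ?_ (lintegral_discounted_const_le_one hα)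
    refine (lintegral_mono fun r => ?_).trans (lintegral_mono_set Set.Ioc_subset_Ioi_self)
    gcongr
    exact (Set.indicator_le_self _ _ _).trans
      (ENNReal.ofReal_le_ofReal (indicator_le_supOn hc _))

/-- The resolvent of `c` at the rate `sup c` is a lower bound for `sup u - u`. -/
theorem resolvent_le_sup_sub (hD : IsOpen D) (hD' : Dᶜ.Nonempty) (h1 : a.Local D) (h2 : a.Levy)
    (hP : a.IsStrongMarkovSolution P) {c g u : Space d → ℝ} (hc : BddNonnegBorel D c)
    (hu : IsWeakSubsolution P D c g u) (hM : 0 ≤ supOn (a.extDomain D) u) {x : Space d}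
    (hx : x ∈ D) :
    ENNReal.ofReal (supOn (a.extDomain D) u * (1 / 2)) * resolvent P D (supOn D c) c x ≤
      ENNReal.ofReal (supOn (a.extDomain D) u - u x) := by
  have := hP.isMarkovKernel
  set M := supOn (a.extDomain D) u with hMdef
  have hmc : Measurable fun z => ENNReal.ofReal (D.indicator c z) :=
    (measurable_indicator_of_subtype hD hc.measurable).ennreal_ofReal
  set F : ℝ → ℝ≥0∞ := fun r => ENNReal.ofReal (Real.exp (-supOn D c * r)) *
    killed P D r.toNNReal (fun z => ENNReal.ofReal (D.indicator c z)) x with hF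
  have hres : resolvent P D (supOn D c) c x = ∫⁻ r in Set.Ioi (0 : ℝ), F r := by
    refine setLIntegral_congr_fun measurableSet_Ioi fun r _ => ?_
    simp only [hF]
    rw [semigroup_eq_killed hP hD hD' h1 h2 hx r.toNNReal
      (h := fun z => ENNReal.ofReal (D.indicator c z)) fun z hz => by
        rw [Set.indicator_of_mem hz]]
  have hfin : ∀ n : ℕ, ENNReal.ofReal (M * (1 / 2)) * ∫⁻ r in Set.Ioc (0 : ℝ) n, F r ≤
      ENNReal.ofReal (M - u x) := by
    intro n
    have hmeas := (by fun_prop : Measurable fun p : ℝ × Path d =>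
      ENNReal.ofReal (Real.exp (-supOn D c * p.1))).mul (measurable_indicator_alive (D := D) hmc)
    have hswap : ∫⁻ r in Set.Ioc (0 : ℝ) n, F r =
        ∫⁻ ω, (∫⁻ r in Set.Ioc (0 : ℝ) ((n : ℝ≥0) : ℝ), ENNReal.ofReal (Real.exp (-supOn D c * r)) *
          {ω | ((r.toNNReal : ℝ≥0) : ℝ≥0∞) < reach D 0 ω}.indicator
            (fun ω => ENNReal.ofReal (D.indicator c (X r.toNNReal ω))) ω) ∂(P x) := by
      rw [← lintegral_lintegral_swap hmeas.aemeasurable, NNReal.coe_natCast]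
      refine lintegral_congr fun r => ?_
      simp only [hF]
      rw [killed_eq_lintegral_indicator, ← lintegral_const_mul' _ _ ENNReal.ofReal_ne_top]
    rw [hswap, ← lintegral_const_mul' _ _ ENNReal.ofReal_ne_top]
    refine lintegral_le_sup_sub hD hD' h1 h2 hP hc hu hM hx n fun ω hω => ?_
    refine (mul_le_mul_right (lintegral_discounted_le hD hc n ω) _).trans ?_
    rw [← ENNReal.ofReal_mul (by positivity)]
    refine ENNReal.ofReal_le_ofReal ?_
    have h3 := half_min_le_one_sub_exp (cost_nonneg hc n ω)
    have h4 := Real.exp_nonneg (-cost D c n ω)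
    nlinarith [mul_le_mul_of_nonneg_left h3 hM, mul_le_mul_of_nonneg_left hω h4]
  have hunion : Set.Ioi (0 : ℝ) = ⋃ n : ℕ, Set.Ioc (0 : ℝ) n := by
    ext r
    simp only [Set.mem_Ioi, Set.mem_iUnion, Set.mem_Ioc]
    exact ⟨fun h => ⟨⌈r⌉₊, h, Nat.le_ceil r⟩, fun ⟨_, h, _⟩ => h⟩
  rw [hres, hunion, setLIntegral_iUnion_of_directed _ (Monotone.directed_le fun m n hmn =>
    Set.Ioc_subset_Ioc le_rfl (Nat.cast_le.2 hmn)), ENNReal.mul_iSup]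
  exact iSup_le hfin

end

section

variable {d : ℕ} {D : Set (Space d)} {a : Coeffs d} {P : Kernel (Space d) (Path d)}

/-! ### Lower bounds from the minorization condition -/

theorem compl_nonempty_of_finiteExit (hP : a.IsStrongMarkovSolution P) (hET : FiniteExit P D)
    {x : Space d} (hx : x ∈ D) : Dᶜ.Nonempty := by
  have := hP.isMarkovKernel
  obtain ⟨ω, hω⟩ := (hET x hx).exists
  by_contra h
  have hD : ∀ z, z ∈ D := fun z => by
    by_contra hz
    exact h ⟨z, hz⟩
  refine hω.ne ?_
  simp [exitTime, hD]

/-- A lower bound by a multiple of `φ`, possibly with infinite constant, gives a real one. -/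
theorem mul_le_of_ofReal_mul_le {κ : ℝ≥0∞} {p w : ℝ} (hw : 0 ≤ w)
    (h : ENNReal.ofReal p * κ ≤ ENNReal.ofReal w) : (min κ 1).toReal * p ≤ w := by
  have hne : min κ 1 ≠ ⊤ := ne_top_of_le_ne_top ENNReal.one_ne_top (min_le_right _ _)
  rw [← ENNReal.ofReal_le_ofReal_iff hw, ENNReal.ofReal_mul ENNReal.toReal_nonneg,
    ENNReal.ofReal_toReal hne, mul_comm]
  exact (mul_le_mul_right (min_le_left _ _) _).trans h

theorem toReal_min_one_pos {κ : ℝ≥0∞} (hκ : κ ≠ 0) : 0 < (min κ 1).toReal :=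
  ENNReal.toReal_pos (lt_min (pos_iff_ne_zero.2 hκ) one_pos).ne'
    (ne_top_of_le_ne_top ENNReal.one_ne_top (min_le_right _ _))

/-- The minorization condition applied to `levelSource`, whose resolvent lies below `v`. -/
theorem supermedian_ge_minorization (hD : IsOpen D) (hD' : Dᶜ.Nonempty) (h1 : a.Local D)
    (h2 : a.Levy) (hP : a.IsStrongMarkovSolution P) {m ν : Measure (Space d)} {φ : Space d → ℝ}
    {lam α : ℝ} (hα : 0 ≤ α) (hM : EigenMinorization P D m φ lam α ν) {v : Space d → ℝ≥0∞}
    (hv : Measurable v) (hsup : Supermedian P D α v) (j : ℕ) {δ : ℝ≥0∞} (hδ : δ ≠ ⊤)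
    {x : Space d} (hx : x ∈ D) :
    ENNReal.ofReal (φ x) * ∫⁻ y in D, levelSource P D j v δ y ∂ν ≤ v x := by
  have := hP.isMarkovKernel
  have hle : ∀ z, levelSource P D j v δ z ≤ δ := fun z =>
    (Set.indicator_le_self _ _ z).trans
      (mul_le_of_le_one_right' (killedBetween_le_one j z))
  have hfin : ∀ z, ENNReal.ofReal (levelSource P D j v δ z).toReal = levelSource P D j v δ z :=
    fun z => ENNReal.ofReal_toReal (ne_top_of_le_ne_top hδ (hle z))
  have hf : BddNonnegBorel D fun z => (levelSource P D j v δ z).toReal :=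
    ⟨((measurable_levelSource j hv δ).ennreal_toReal).comp measurable_subtype_coe,
      fun z _ => ENNReal.toReal_nonneg,
      δ.toReal, fun z _ => ENNReal.toReal_mono hδ (hle z)⟩
  have hmin := hM.minorization _ hf x hx
  simp only [hfin] at hmin
  refine hmin.trans (le_trans (le_of_eq ?_)
    (lintegral_killed_levelSource_le hP hD hD' hα hv hsup j δ hx))
  refine setLIntegral_congr_fun measurableSet_Ioi fun t _ => ?_
  rw [semigroup_eq_killed hP hD hD' h1 h2 hx t.toNNReal fun z _ => hfin z]

/-- If `sup u - u` does not vanish `ν`-almost everywhere on `D`, it dominates a multiple of `φ`. -/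
theorem exists_mul_le_sup_sub (hD : IsOpen D) (h1 : a.Local D) (h2 : a.Levy)
    (hP : a.IsStrongMarkovSolution P) (hET : FiniteExit P D) {c g u : Space d → ℝ}
    (hc : BddNonnegBorel D c) {m ν : Measure (Space d)} {φ : Space d → ℝ} {lam : ℝ}
    (hmin : EigenMinorization P D m φ lam (supOn D c) ν) (hu : IsWeakSubsolution P D c g u)
    (hM : 0 ≤ supOn (a.extDomain D) u)
    (hν : (ν.restrict D) {z | u z < supOn (a.extDomain D) u} ≠ 0) :
    ∃ r : ℝ, 0 < r ∧ ∀ x ∈ D, supOn (a.extDomain D) u - u x ≥ r * φ x := by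
  obtain ⟨C, hC⟩ := hu.bounded
  set M := supOn (a.extDomain D) u with hMdef
  set v : Space d → ℝ≥0∞ := fun z => ENNReal.ofReal (M - u z) with hvdef
  have hv : Measurable v := (hu.measurable.const_sub _).ennreal_ofReal
  have hlevel : ∃ n : ℕ, (ν.restrict D) {z | ENNReal.ofReal (1 / ((n : ℝ) + 1)) ≤ v z} ≠ 0 := by
    by_contra! h
    refine hν (measure_mono_null (fun z hz => ?_) (measure_iUnion_null h))
    obtain ⟨n, hn⟩ := exists_nat_one_div_lt (sub_pos.2 (show u z < M from hz))
    exact Set.mem_iUnion.2 ⟨n, ENNReal.ofReal_le_ofReal hn.le⟩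
  obtain ⟨n, hn⟩ := hlevel
  set δ := ENNReal.ofReal (1 / ((n : ℝ) + 1)) with hδ
  have hδ0 : δ ≠ 0 := (ENNReal.ofReal_pos.2 (by positivity)).ne'
  have hj : ∃ j : ℕ, ∫⁻ y in D, levelSource P D j v δ y ∂ν ≠ 0 := by
    by_contra! h
    have hsum : ∫⁻ y in D, ∑' j, levelSource P D j v δ y ∂ν = 0 := by
      rw [lintegral_tsum fun j => (measurable_levelSource j hv δ).aemeasurable]
      simp [h]
    have heq : ∫⁻ y in D, ∑' j, levelSource P D j v δ y ∂ν =
        ∫⁻ y in D, {z | δ ≤ v z}.indicator (fun _ => δ) y ∂ν := by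
      refine setLIntegral_congr_fun hD.measurableSet fun y hy => ?_
      by_cases hmem : δ ≤ v y
      · simp only [levelSource, Set.indicator_of_mem (show y ∈ {z | δ ≤ v z} from hmem)]
        rw [ENNReal.tsum_mul_left,
          tsum_killedBetween hP hD (compl_nonempty_of_finiteExit hP hET hy) hET hy, mul_one]
      · simp [levelSource, Set.indicator_of_notMem (show y ∉ {z | δ ≤ v z} from hmem)]
    rw [heq, lintegral_indicator_const (measurableSet_le measurable_const hv)] at hsum
    exact (mul_ne_zero hδ0 hn) hsum
  obtain ⟨j, hj⟩ := hj
  refine ⟨_, toReal_min_one_pos hj, fun x hx => ?_⟩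
  have hD' := compl_nonempty_of_finiteExit hP hET hx
  exact mul_le_of_ofReal_mul_le
    (sub_nonneg.2 (le_supOn_of_mem hC hx))
    (supermedian_ge_minorization hD hD' h1 h2 hP (supOn_nonneg hc) hmin hv
      (supermedian_sup_sub hD hD' h1 h2 hP hc hu hM) j ENNReal.ofReal_ne_top hx)

end

end LevyHopf

theorem corollary3p14 {d : ℕ}
    (D : Set (LevyHopf.Space d)) (hD_open : IsOpen D) (hD_conn : IsConnected D)
    (a : LevyHopf.Coeffs d) (hA1 : a.Local D) (hA2 : a.Levy)
    (c : LevyHopf.Space d → ℝ) (hA3 : LevyHopf.BddNonnegBorel D c)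
    (P : Kernel (LevyHopf.Space d) (LevyHopf.Path d)) (hA4 : a.IsStrongMarkovSolution P)
    (hET : LevyHopf.FiniteExit P D)
    (g : LevyHopf.Space d → ℝ) (hg_meas : Measurable fun x : D => g x) (hg : ∀ x ∈ D, g x ≤ 0)
    (m : Measure (LevyHopf.Space d)) [SigmaFinite m]
    (φ : LevyHopf.Space d → ℝ) (lam : ℝ) (ν : Measure (LevyHopf.Space d))
    (hM : LevyHopf.EigenMinorization P D m φ lam (LevyHopf.supOn D c) ν) :
    -- 1) the support of `ν` as a measure on `D` is `D`
    (D ⊆ (ν.restrict D).support →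
      ∀ u : LevyHopf.Space d → ℝ, LevyHopf.IsWeakSubsolution P D c g u →
        0 ≤ LevyHopf.supOn (a.extDomain D) u →
        ContinuousOn u D → (¬ ∃ k : ℝ, ∀ x ∈ D, u x = k) →
        ∃ r : ℝ, 0 < r ∧ ∀ x ∈ D, LevyHopf.supOn (a.extDomain D) u - u x ≥ r * φ x) ∧
    -- 2)
    (m.restrict D ≪ ν.restrict D →
      ∀ u : LevyHopf.Space d → ℝ, LevyHopf.IsWeakSubsolution P D c g u →
        0 ≤ LevyHopf.supOn (a.extDomain D) u →
        (¬ ∃ k : ℝ, ∀ᵐ x ∂(m.restrict D), u x = k) →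
        ∃ r : ℝ, 0 < r ∧ ∀ x ∈ D, LevyHopf.supOn (a.extDomain D) u - u x ≥ r * φ x) ∧
    -- 3)
    (m.restrict D ≪ ν.restrict D → 0 < ∫⁻ x in D, ENNReal.ofReal (c x) ∂m →
      ∃ r : ℝ, 0 < r ∧ ∀ u : LevyHopf.Space d → ℝ, LevyHopf.IsWeakSubsolution P D c g u →
        ∀ x ∈ D, LevyHopf.supOn (a.extDomain D) u - u x
          ≥ r * LevyHopf.supOn (a.extDomain D) u * φ x) := by
  -- In the first two parts it remains to see that `sup u - u` is charged by `ν`.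
  refine ⟨fun hsupp u hu hM0 hcont hconst => ?_, fun hac u hu hM0 hconst => ?_,
    fun hac hcpos => ?_⟩
  · obtain ⟨C, hC⟩ := hu.bounded
    refine LevyHopf.exists_mul_le_sup_sub hD_open hA1 hA2 hA4 hET hA3 hM hu hM0 ?_
    obtain ⟨x, hx, hlt⟩ : ∃ x ∈ D, u x < LevyHopf.supOn (a.extDomain D) u := by
      by_contra! h
      exact hconst ⟨_, fun x hx => le_antisymm (LevyHopf.le_supOn_of_mem hC hx) (h x hx)⟩
    refine ((Measure.mem_support_iff_forall x).1 (hsupp hx) _ ?_).ne'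
    exact (hcont.continuousAt (hD_open.mem_nhds hx)).eventually_lt_const hlt
  · obtain ⟨C, hC⟩ := hu.bounded
    refine LevyHopf.exists_mul_le_sup_sub hD_open hA1 hA2 hA4 hET hA3 hM hu hM0 fun h0 => ?_
    refine hconst ⟨LevyHopf.supOn (a.extDomain D) u, ?_⟩
    filter_upwards [measure_eq_zero_iff_ae_notMem.1 (hac h0),
      ae_restrict_mem hD_open.measurableSet] with x hx hxD
    exact le_antisymm (LevyHopf.le_supOn_of_mem hC hxD) (not_lt.1 hx)
  -- The constant is half of `∫_D c dν`, truncated at `1` since the integral may be infinite.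
  · have hind : ∀ κ : Measure (LevyHopf.Space d), ∫⁻ x in D, ENNReal.ofReal (c x) ∂κ =
        ∫⁻ x in D, ENNReal.ofReal (D.indicator c x) ∂κ := fun κ =>
      setLIntegral_congr_fun hD_open.measurableSet fun x hx => by
        simp only [Set.indicator_of_mem hx]
    have hmc : Measurable fun x => ENNReal.ofReal (D.indicator c x) :=
      (LevyHopf.measurable_indicator_of_subtype hD_open hA3.measurable).ennreal_ofReal
    have hκ : ∫⁻ x in D, ENNReal.ofReal (c x) ∂ν ≠ 0 := by
      intro h
      rw [hind, lintegral_eq_zero_iff hmc] at h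
      rw [hind, (lintegral_eq_zero_iff hmc).2 (hac.ae_le h)] at hcpos
      exact lt_irrefl _ hcpos
    refine ⟨1 / 2 * (min (∫⁻ x in D, ENNReal.ofReal (c x) ∂ν) 1).toReal,
      mul_pos (by norm_num) (LevyHopf.toReal_min_one_pos hκ), fun u hu x hx => ?_⟩
    obtain ⟨C, hC⟩ := hu.bounded
    have hD' := LevyHopf.compl_nonempty_of_finiteExit hA4 hET hx
    have hφ := hM.isEigen.nonneg x hx
    have hnn := sub_nonneg.2 (LevyHopf.le_supOn_of_mem (a := a) hC hx)
    rcases le_or_gt 0 (LevyHopf.supOn (a.extDomain D) u) with hM0 | hM0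
    · have h1 := LevyHopf.resolvent_le_sup_sub hD_open hD' hA1 hA2 hA4 hA3 hu hM0 hx
      have h2 := (mul_le_mul_right (hM.minorization c hA3 x hx) _).trans h1
      rw [← mul_assoc, ← ENNReal.ofReal_mul (by positivity)] at h2
      have h3 := LevyHopf.mul_le_of_ofReal_mul_le hnn h2
      linarith
    -- For a negative supremum the right-hand side is non-positive.
    · have h1 := LevyHopf.toReal_min_one_pos hκ
      have h2 := mul_nonneg h1.le hφ
      nlinarith [mul_nonneg h2 (neg_nonneg.2 hM0.le)]
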